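/- Let $n\ge 2$ and let $(X^{n+1},M,Q)$ be a cornered space: $X$ is a smooth manifold with corners of codimension two, $\partial X=M\cup Q$, where $M$ and $Q$ are embedded hypersurfaces with boundary that meet exactly in their mutual boundary $S=M\cap Q$, which is the entire corner of $X$ and is compact and nonempty. A smooth defining function for $M$ is a function $\varphi\in C^\infty(X)$, $\varphi\ge 0$, with $\varphi^{-1}(0)=M$ and $d\varphi\neq 0$ along $M$. A ($C^k$ or smooth) cornered asymptotically hyperbolic (CAH) metric is a smooth Riemannian metric $g$ on $X\setminus M$ such that for each such $\varphi$ the metric $\varphi^2 g$ extends to a ($C^k$ or smooth) metric $\bar g$ on $X$, and such that $|d\varphi|_{\bar g}=1$ along $M$ for some (hence any) such $\varphi$. Let $b:\widetilde X\to X$ be the blow-up of $X$ along $S$ (polar coordinates $y=\rho\sin\theta$, $x=\rho\cos\theta$, where $y,x\ge 0$ are local defining functions of $M$, $Q$ and $0\le\theta\le\pi/2$), let $\widetilde S=b^{-1}(S)=\{\rho=0\}$, let $\widetilde M=\{\theta=0\}$ be the lift of $M$, and let ${}^{0e}T^*\widetilde X$ be the bundle over $\widetilde X$ spanned by $\frac{d\theta}{\sin\theta},\frac{dx^s}{\rho\sin\theta},\frac{d\rho}{\rho\sin\theta}$,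 where the $x^s$ are lifts of local functions on $X$ that restrict to coordinates of $S$. A metric $g$ on $X\setminus M$ is admissible if $b^*g$ extends to a smooth positive definite section of $S^2({}^{0e}T^*\widetilde X)$ of the form $b^*g_++\mathcal L$, where $g_+$ is a smooth CAH metric on $X$ and $\mathcal L$ is a smooth section of $S^2({}^{0e}T^*\widetilde X)$ that vanishes on $\widetilde S$ and $\widetilde M$. Let $g$ be a smooth Einstein metric on $X\setminus M$, $\mathrm{Ric}(g)=-n\,g$, and let $\lambda\in\mathbb R$ be such that $K_Q=\lambda\, g|_{TQ}$ on $Q\setminus S$, where $K_Q(Y,Z)=\langle\nabla_YZ,\nu\rangle_g$ is the second fundamental form of $Q$ with respect to the inward-pointing $g$-unit normal $\nu$. (a) Suppose that $g$ is a smooth CAH metric or, more generally, an admissible metric. Let $\varphi$ be any smooth defining function for $M$ and let $\bar g$ be the continuous metric on $X$ extending $\varphi^2g$. For $p\in S$ let $\theta_0(p)=\cos^{-1}\bar g(u,v)$ be the $\bar g$-angle between $M$ and $Q$ at $p$, where $u$ (resp. $v$) is the $\bar g$-unit vector tangent to $M$ (resp. $Q$), normal to $S$ and pointing into $M$ (resp.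 $Q$). Then $\cos\theta_0(p)=-\lambda$ for every $p\in S$. In particular, $\lambda\in(-1,1)$. (b) Suppose that $g$ is a smooth CAH metric (that is, its compactifications $\varphi^2g$ are smooth up to $M$), and let $[h]$ be its conformal infinity: the class of all metrics $h=\Omega^2\,\varphi^2g|_{TM}$ on $M$, where $\varphi$ is a smooth defining function for $M$ and $\Omega\in C^\infty(M)$ is nowhere zero. Then $S$ is (totally) umbilic in $(M,h)$ for every $h\in[h]$, i.e. at each point of $S$ the second fundamental form of $S$ in $(M,h)$ is a multiple of $h|_{TS}$. -/

import Mathlib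

open scoped Manifold ContDiff
open Bundle

noncomputable section

/-! ### Coordinate tensor calculus on a quadrant -/

/-- The closed quadrant `{y | 0 ≤ y i for all i}` of `ℝᵐ`, in which coordinate charts of manifolds
with corners take their values. -/
def quadrant (m : ℕ) : Set (EuclideanSpace ℝ (Fin m)) := {y | ∀ i, 0 ≤ y i}

/-- The partial derivative `∂ᵢ f`, taken within the quadrant (so it is one-sided on its faces). -/
def pderiv {m : ℕ} (i : Fin m) (f : EuclideanSpace ℝ (Fin m) → ℝ)
    (y : EuclideanSpace ℝ (Fin m)) : ℝ :=
  fderivWithin ℝ f (quadrant m) y (EuclideanSpace.single i 1)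

/-- The Christoffel symbol `Γᵏᵢⱼ = ½ gᵏˡ (∂ᵢ gⱼₗ + ∂ⱼ gᵢₗ - ∂ₗ gᵢⱼ)` of a metric `G` given by its
components. -/
def christoffel {m : ℕ} (G : EuclideanSpace ℝ (Fin m) → Matrix (Fin m) (Fin m) ℝ)
    (k i j : Fin m) (y : EuclideanSpace ℝ (Fin m)) : ℝ :=
  (1 / 2) * ∑ l, (G y)⁻¹ k l *
    (pderiv i (fun x => G x j l) y + pderiv j (fun x => G x i l) y - pderiv l (fun x => G x i j) y)

/-- The component
`Rᵢⱼ = ∂ₖ Γᵏᵢⱼ - ∂ⱼ Γᵏᵢₖ + Γᵏₖₗ Γˡᵢⱼ - Γᵏⱼₗ Γˡᵢₖ` of the Ricci tensor (positive on round spheres). -/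
def ricci {m : ℕ} (G : EuclideanSpace ℝ (Fin m) → Matrix (Fin m) (Fin m) ℝ)
    (i j : Fin m) (y : EuclideanSpace ℝ (Fin m)) : ℝ :=
  ∑ k, (pderiv k (christoffel G k i j) y - pderiv j (christoffel G k i k) y)
    + ∑ k, ∑ l, (christoffel G k k l y * christoffel G l i j y
        - christoffel G k j l y * christoffel G l i k y)

/-- The unit normal `grad yᵏ / |grad yᵏ|` of the level sets of the coordinate `yᵏ`, pointing towards
increasing `yᵏ`; its components are `gᵏˡ / √gᵏᵏ`. -/
def coordNormal {m : ℕ} (G : EuclideanSpace ℝ (Fin m) → Matrix (Fin m) (Fin m) ℝ)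
    (k l : Fin m) (y : EuclideanSpace ℝ (Fin m)) : ℝ :=
  (G y)⁻¹ k l / √((G y)⁻¹ k k)

/-- The scalar second fundamental form `K(∂ᵢ, ∂ⱼ) = ⟨∇_{∂ᵢ} ∂ⱼ, ν⟩` of the level sets of the
coordinate `yᵏ` with respect to the unit normal `ν` pointing towards increasing `yᵏ`. It is meant
for indices `i, j ≠ k`, for which `∂ᵢ, ∂ⱼ` are tangent to the level set. On the face `yᵏ = 0`, `ν` is
the inward-pointing unit normal. -/
def secondFundForm {m : ℕ} (G : EuclideanSpace ℝ (Fin m) → Matrix (Fin m) (Fin m) ℝ)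
    (k i j : Fin m) (y : EuclideanSpace ℝ (Fin m)) : ℝ :=
  ∑ p, ∑ q, G y p q * christoffel G p i j y * coordNormal G k q y

/-! ### Cornered spaces

`X` has dimension `d + 2`; its boundary hypersurfaces `M`, `Q` have dimension `n = d + 1`, and the
corner `S = M ∩ Q` has dimension `d`. -/

/-- The model with corners of `X`. -/
abbrev cornerModel (d : ℕ) :
    ModelWithCorners ℝ (EuclideanSpace ℝ (Fin (d + 2))) (EuclideanQuadrant (d + 2)) :=
  modelWithCornersEuclideanQuadrant (d + 2)

/-- A field of bilinear forms on the tangent spaces of `X`. -/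
abbrev BilinField (d : ℕ) (X : Type*) [TopologicalSpace X]
    [ChartedSpace (EuclideanQuadrant (d + 2)) X] : Type _ :=
  ∀ x : X, TangentSpace (cornerModel d) x →L[ℝ] TangentSpace (cornerModel d) x →L[ℝ] ℝ

section

variable {d : ℕ} {X : Type*} [TopologicalSpace X] [ChartedSpace (EuclideanQuadrant (d + 2)) X]

/-- A smooth chart of `X` is adapted to `M` and `Q` if in it `M` is the face where the first
coordinate vanishes, `Q` is the face where the last coordinate vanishes, and the remaining
coordinates are positive (they run over an open set; so corners have codimension at most two). -/
structure IsAdaptedChart (M Q : Set X) (e : OpenPartialHomeomorph X (EuclideanQuadrant (d + 2))) :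
    Prop where
  mem_maximalAtlas : e ∈ IsManifold.maximalAtlas (cornerModel d) ∞ X
  mem_M_iff : ∀ x ∈ e.source, x ∈ M ↔ (e x).1 0 = 0
  mem_Q_iff : ∀ x ∈ e.source, x ∈ Q ↔ (e x).1 (Fin.last (d + 1)) = 0
  pos : ∀ x ∈ e.source, ∀ i, i ≠ 0 → i ≠ Fin.last (d + 1) → 0 < (e x).1 i

/-- `(X, M, Q)` is a cornered space: `X` is a manifold with corners of codimension two, its boundary
is the union of the embedded hypersurfaces with boundary `M` and `Q`, which meet exactly in their
mutual boundary `S = M ∩ Q`, the whole corner of `X`; and `S` is compact and nonempty. -/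
structure IsCorneredSpace (M Q : Set X) : Prop where
  exists_adapted : ∀ x : X, ∃ e : OpenPartialHomeomorph X (EuclideanQuadrant (d + 2)),
    IsAdaptedChart M Q e ∧ x ∈ e.source
  corner_nonempty : (M ∩ Q).Nonempty
  corner_compact : IsCompact (M ∩ Q)

/-- The value of a bilinear form field on two vectors given by their components `v`, `w` in the
coordinate frame of the chart `e`, at the point with coordinates `y`. -/
def chartForm (e : OpenPartialHomeomorph X (EuclideanQuadrant (d + 2))) (T : BilinField d X)
    (y v w : EuclideanSpace ℝ (Fin (d + 2))) : ℝ :=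
  T ((e.extend (cornerModel d)).symm y)
    (mfderivWithin 𝓘(ℝ, EuclideanSpace ℝ (Fin (d + 2))) (cornerModel d)
      (e.extend (cornerModel d)).symm (Set.range (cornerModel d)) y v)
    (mfderivWithin 𝓘(ℝ, EuclideanSpace ℝ (Fin (d + 2))) (cornerModel d)
      (e.extend (cornerModel d)).symm (Set.range (cornerModel d)) y w)

/-- The components `T(∂ᵢ, ∂ⱼ)` of a bilinear form field in the chart `e`. -/
def chartComponents (e : OpenPartialHomeomorph X (EuclideanQuadrant (d + 2))) (T : BilinField d X)
    (y : EuclideanSpace ℝ (Fin (d + 2))) : Matrix (Fin (d + 2)) (Fin (d + 2)) ℝ :=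
  fun i j => chartForm e T y (EuclideanSpace.single i 1) (EuclideanSpace.single j 1)

/-- A smooth defining function for the boundary hypersurface `M`. -/
structure IsDefiningFunction (M : Set X) (φ : X → ℝ) : Prop where
  contMDiff : ContMDiff (cornerModel d) 𝓘(ℝ, ℝ) ∞ φ
  nonneg : ∀ x, 0 ≤ φ x
  eq_zero_iff : ∀ x, φ x = 0 ↔ x ∈ M
  mfderiv_ne_zero : ∀ x ∈ M, mfderiv (cornerModel d) 𝓘(ℝ, ℝ) φ x ≠ 0

/-! ### Cornered asymptotically hyperbolic metrics -/

variable [IsManifold (cornerModel d) ∞ X]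

variable (d X) in
/-- Riemannian metrics of class `Cᵏ` on all of `X`. -/
abbrev CkMetric (k : ℕ∞ω) : Type _ :=
  ContMDiffRiemannianMetric (cornerModel d) k (EuclideanSpace ℝ (Fin (d + 2)))
    (fun x : X => TangentSpace (cornerModel d) x)

/-- `g` is a smooth Riemannian metric on `X \ M` (its values on `M` are irrelevant). -/
structure IsMetricOff (M : Set X) (g : BilinField d X) : Prop where
  symm : ∀ x ∉ M, ∀ v w, g x v w = g x w v
  pos : ∀ x ∉ M, ∀ v, v ≠ 0 → 0 < g x v v
  contMDiffOn : ContMDiffOn (cornerModel d)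
    ((cornerModel d).prod 𝓘(ℝ, EuclideanSpace ℝ (Fin (d + 2)) →L[ℝ]
      EuclideanSpace ℝ (Fin (d + 2)) →L[ℝ] ℝ)) ∞
    (fun x => TotalSpace.mk' (EuclideanSpace ℝ (Fin (d + 2)) →L[ℝ]
      EuclideanSpace ℝ (Fin (d + 2)) →L[ℝ] ℝ)
      (E := fun x : X => TangentSpace (cornerModel d) x →L[ℝ] TangentSpace (cornerModel d) x →L[ℝ] ℝ)
      x (g x)) Mᶜ

/-- The `Cᵏ` metric `gbar` on `X` is the compactification `φ² g` of `g`. -/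
def IsCompactification {k : ℕ∞ω} (M : Set X) (g : BilinField d X) (φ : X → ℝ)
    (gbar : CkMetric d X k) : Prop :=
  ∀ x ∉ M, gbar.inner x = φ x ^ 2 • g x

/-- `|dφ| = 1` at `x` with respect to `gbar`: the gradient of `φ` is a unit vector. -/
def HasUnitDifferential {k : ℕ∞ω} (gbar : CkMetric d X k) (φ : X → ℝ) (x : X) : Prop :=
  ∃ u : TangentSpace (cornerModel d) x,
    (∀ w, gbar.inner x u w = mfderiv (cornerModel d) 𝓘(ℝ, ℝ) φ x w) ∧ gbar.inner x u u = 1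

/-- `g` is a cornered asymptotically hyperbolic metric on `(X, M, Q)` with compactifications of
class `Cᵏ`. -/
structure IsCAHMetric (k : ℕ∞ω) (M : Set X) (g : BilinField d X) : Prop where
  isMetricOff : IsMetricOff M g
  exists_compactification : ∀ φ : X → ℝ, IsDefiningFunction (d := d) M φ →
    ∃ gbar : CkMetric d X k, IsCompactification M g φ gbar
  asymptotically_hyperbolic : ∃ (φ : X → ℝ) (gbar : CkMetric d X k),
    IsDefiningFunction (d := d) M φ ∧ IsCompactification M g φ gbar ∧
      ∀ x ∈ M, HasUnitDifferential gbar φ x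

end

/-! ### The blow-up of the corner and admissible metrics

Blowing up `S` replaces the coordinates `(y₀, y_last)` of an adapted chart by polar coordinates
`y₀ = ρ sin θ`, `y_last = ρ cos θ`, `0 ≤ θ ≤ π / 2`, `0 ≤ ρ`. The charts `(θ, …, ρ)` obtained in this
way from all adapted charts form an atlas of the blow-up: `ρ = 0` is the front face, which lies over
`S`, and `θ = 0` is the lift of `M`. A chart that does not meet `S` has `ρ > 0` and is only
reparametrized. -/

/-- The blow-down map in the coordinates `(θ, x, ρ)`; `θ` is the first and `ρ` the last
coordinate. -/
def polarMap {d : ℕ} (z : EuclideanSpace ℝ (Fin (d + 2))) : EuclideanSpace ℝ (Fin (d + 2)) :=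
  WithLp.toLp 2 fun i =>
    if i = 0 then z (Fin.last (d + 1)) * Real.sin (z 0)
    else if i = Fin.last (d + 1) then z (Fin.last (d + 1)) * Real.cos (z 0)
    else z i

/-- The push-forward to `X`-coordinates of the frame `sin θ ∂_θ`, `ρ sin θ ∂_x`, `ρ sin θ ∂_ρ` of
0-edge vector fields. -/
def zeroEdgeFrame {d : ℕ} (z : EuclideanSpace ℝ (Fin (d + 2))) (i : Fin (d + 2)) :
    EuclideanSpace ℝ (Fin (d + 2)) :=
  (if i = 0 then Real.sin (z 0) else z (Fin.last (d + 1)) * Real.sin (z 0)) •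
    fderiv ℝ polarMap z (EuclideanSpace.single i 1)

section

variable {d : ℕ} {X : Type*} [TopologicalSpace X] [ChartedSpace (EuclideanQuadrant (d + 2)) X]

/-- The range of the polar coordinates on the preimage, in the blow-up, of the domain of `e`. -/
def polarDomain (e : OpenPartialHomeomorph X (EuclideanQuadrant (d + 2))) :
    Set (EuclideanSpace ℝ (Fin (d + 2))) :=
  {z | 0 ≤ z 0 ∧ z 0 ≤ Real.pi / 2 ∧ 0 ≤ z (Fin.last (d + 1)) ∧
    polarMap z ∈ (e.extend (cornerModel d)).target}

/-- In the blow-up chart given by `e`, the lift of `T` (a tensor field on `X \ M`) extends to a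
smooth section of the symmetric square of the 0-edge cotangent bundle, whose components in the
0-edge coframe `dθ / sin θ`, `dx / (ρ sin θ)`, `dρ / (ρ sin θ)` are `B`. -/
structure IsZeroEdgeLift (e : OpenPartialHomeomorph X (EuclideanQuadrant (d + 2)))
    (T : BilinField d X)
    (B : EuclideanSpace ℝ (Fin (d + 2)) → Matrix (Fin (d + 2)) (Fin (d + 2)) ℝ) : Prop where
  symm : ∀ z ∈ polarDomain e, (B z).IsSymm
  contDiffOn : ∀ i j, ContDiffOn ℝ ∞ (fun z => B z i j) (polarDomain e)
  eq_components : ∀ z ∈ polarDomain e, 0 < z 0 → 0 < z (Fin.last (d + 1)) →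
    ∀ i j, B z i j = chartForm e T (polarMap z) (zeroEdgeFrame z i) (zeroEdgeFrame z j)

variable [IsManifold (cornerModel d) ∞ X]

/-- `g` is an admissible metric on the cornered space `(X, M, Q)`: its lift to the blow-up is a
0-edge metric, and is the sum of the lift of a smooth CAH metric and of a smooth section `L` of the
symmetric square of the 0-edge cotangent bundle that vanishes on the front face (`ρ = 0`) and on the
lift of `M` (`θ = 0`). -/
structure IsAdmissible (M Q : Set X) (g : BilinField d X) : Prop where
  isMetricOff : IsMetricOff M g
  zeroEdge : ∀ e, IsAdaptedChart M Q e →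
    ∃ B, IsZeroEdgeLift e g B ∧ ∀ z ∈ polarDomain e, (B z).PosDef
  exists_smooth : ∃ (gplus L : BilinField d X), IsCAHMetric ∞ M gplus ∧
    (∀ x ∉ M, g x = gplus x + L x) ∧
    ∀ e, IsAdaptedChart M Q e → ∃ B, IsZeroEdgeLift e L B ∧
      ∀ z ∈ polarDomain e, z 0 = 0 ∨ z (Fin.last (d + 1)) = 0 → B z = 0

/-! ### The Einstein condition, the boundary condition, the angle and umbilicity -/

/-- `g` is an Einstein metric on `X \ M`, normalized as for hyperbolic space: `Ric(g) = -n g` with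
`n + 1 = dim X`. -/
def IsEinstein (M : Set X) (g : BilinField d X) : Prop :=
  ∀ e ∈ IsManifold.maximalAtlas (cornerModel d) ∞ X, ∀ y ∈ (e.extend (cornerModel d)).target,
    (e.extend (cornerModel d)).symm y ∉ M →
    ∀ i j, ricci (chartComponents e g) i j y = -((d : ℝ) + 1) * chartComponents e g y i j

/-- `K_Q = lam • g` on `TQ` over `Q \ S`, where `K_Q` is the second fundamental form of `Q` with
respect to the inward-pointing `g`-unit normal. In an adapted chart `TQ` is spanned by the coordinate
fields other than the last. -/
def HasUmbilicBoundary (M Q : Set X) (g : BilinField d X) (lam : ℝ) : Prop :=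
  ∀ e, IsAdaptedChart M Q e → ∀ y ∈ (e.extend (cornerModel d)).target,
    (e.extend (cornerModel d)).symm y ∈ Q → (e.extend (cornerModel d)).symm y ∉ M →
    ∀ i j, i ≠ Fin.last (d + 1) → j ≠ Fin.last (d + 1) →
      secondFundForm (chartComponents e g) (Fin.last (d + 1)) i j y
        = lam * chartComponents e g y i j

/-- `θ` is the angle between `M` and `Q` at the corner point `p` with respect to `gbar`: the angle
between the unit vectors `u` and `v`, where `u` is tangent to `M`, normal to `S` and points into `M`,
and `v` is tangent to `Q`, normal to `S` and points into `Q`. All vectors are given by their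
components in the adapted chart `e`, so that `TM` is `w 0 = 0` and `TQ` is `w last = 0`. -/
def IsCornerAngle {k : ℕ∞ω} (e : OpenPartialHomeomorph X (EuclideanQuadrant (d + 2)))
    (gbar : CkMetric d X k) (p : X) (θ : ℝ) : Prop :=
  ∃ u v : EuclideanSpace ℝ (Fin (d + 2)),
    let G := chartForm e gbar.inner (e.extend (cornerModel d) p)
    (u 0 = 0 ∧ 0 < u (Fin.last (d + 1)) ∧ G u u = 1) ∧
    (v (Fin.last (d + 1)) = 0 ∧ 0 < v 0 ∧ G v v = 1) ∧
    (∀ w : EuclideanSpace ℝ (Fin (d + 2)), w 0 = 0 → w (Fin.last (d + 1)) = 0 →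
      G u w = 0 ∧ G v w = 0) ∧
    θ = Real.arccos (G u v)

/-- The face `y₀ = 0`, which is `M` in an adapted chart, parametrized by the other coordinates. -/
def faceM {d : ℕ} (y : EuclideanSpace ℝ (Fin (d + 1))) : EuclideanSpace ℝ (Fin (d + 2)) :=
  WithLp.toLp 2 (Fin.cons 0 fun i => y i)

/-- The components on `M`, in the coordinates other than the first of an adapted chart `e`, of the
metric `Ω² gbar|_{TM}`. -/
def metricOnM {k : ℕ∞ω} (e : OpenPartialHomeomorph X (EuclideanQuadrant (d + 2)))
    (gbar : CkMetric d X k) (Ω : X → ℝ) (y : EuclideanSpace ℝ (Fin (d + 1))) :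
    Matrix (Fin (d + 1)) (Fin (d + 1)) ℝ :=
  fun a b => Ω ((e.extend (cornerModel d)).symm (faceM y)) ^ 2 *
    chartComponents e gbar.inner (faceM y) a.succ b.succ

/-- `S = M ∩ Q` is (totally) umbilic as a hypersurface of `M` with the metric `h = Ω² gbar|_{TM}`: at
each point of `S`, its second fundamental form in `(M, h)` is a multiple of `h`. In an adapted chart
`S` is the face of `M` where the last coordinate vanishes. -/
def IsUmbilicCorner {k : ℕ∞ω} (M Q : Set X) (gbar : CkMetric d X k) (Ω : X → ℝ) : Prop :=
  ∀ e, IsAdaptedChart M Q e → ∀ y : EuclideanSpace ℝ (Fin (d + 1)),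
    faceM y ∈ (e.extend (cornerModel d)).target → y (Fin.last d) = 0 →
    ∃ η : ℝ, ∀ a b, a ≠ Fin.last d → b ≠ Fin.last d →
      secondFundForm (metricOnM e gbar Ω) (Fin.last d) a b y = η * metricOnM e gbar Ω y a b

end

end

/-!
The argument is local near a corner point `p`, in an adapted chart, and takes limits along the curve
`t ↦ p + t e₀`, which runs in `Q` and leaves `M` as `t > 0` grows.

The angle. Along this curve `t² g` tends to a positive definite matrix `A`, and `t³ ∂ₖ g` tends to the
derivative of the model metric `y₀⁻² A` (`HasScalingLimit`). For a metric `φ⁻² gbar` with `gbar` smooth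
this is a direct computation (`hasScalingLimit_of_compactification`), and `|dφ| = 1` becomes
`A⁰⁰ = 1`. An admissible metric differs from such a metric by a tensor `L` that is smooth in the
zero-edge coframe and vanishes on the front face; since the `θ`-direction is tangent to the front
face, neither `L` nor its first derivatives contribute to the limit
(`IsZeroEdgeLift.hasScalingLimit_zero`). The second fundamental form of `Q` scales like the metric, so
that the equation `K_Q = lam g`, applied to the vector `e₀`, has a limit, which reads
`lam √Aˡˡ = Aˡ⁰` with `l` the last index (`HasScalingLimit.lam_mul_sqrt`). Thus `lam` is the inner
product of the unit conormals of `M` and `Q`, which is minus the cosine of the angle between the faces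
(`dotProduct_mulVec_mul_sqrt`). Every continuous compactification is conformal to `A` at `p`, and
angles are conformally invariant.

Umbilicity. Being pure trace is a conformally invariant property of second fundamental forms
(`christoffel_smul`), so `K_Q = lam g` implies that `Q` is umbilic for `gbar`, up to the corner
(`exists_christoffel_last_eq_mul`). By the conformal change of the Ricci tensor
(`exists_ricci_smul`), the Einstein equation times `φ` is, modulo multiples of `gbar`, equal to
`d ∇² φ + φ Ric(gbar) = 0`, where `d = n - 1` is positive. Hence `∇² φ` is pure trace at `φ = 0`, that
is, `M` is umbilic for `gbar` (`exists_christoffel_zero_eq_mul`). The normal of `S` in `M` is a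
combination of the normals of `M` and of `Q`, so `S` is umbilic in `M`
(`exists_christoffel_face_eq_mul`), for `gbar` and for every metric conformal to it.
-/

open Filter Topology

/-! ### Calculus on open subsets of the quadrant -/

theorem convex_quadrant (m : ℕ) : Convex ℝ (quadrant m) :=
  EuclideanQuadrant.convex

theorem uniqueDiffOn_quadrant (m : ℕ) : UniqueDiffOn ℝ (quadrant m) := by
  refine uniqueDiffOn_convex (convex_quadrant m) ?_
  have h : interior (quadrant m) = {y | ∀ i : Fin m, 0 < y i} := interior_euclideanQuadrant m 2 0
  rw [h]
  exact ⟨WithLp.toLp 2 fun _ => 1, by simp⟩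

/-- `U` is a relatively open subset of the quadrant. -/
structure IsOpenInQuadrant {m : ℕ} (U : Set (EuclideanSpace ℝ (Fin m))) : Prop where
  subset : U ⊆ quadrant m
  mem_nhdsWithin : ∀ y ∈ U, U ∈ 𝓝[quadrant m] y

section

variable {m : ℕ} {U : Set (EuclideanSpace ℝ (Fin m))} {f g : EuclideanSpace ℝ (Fin m) → ℝ}
  {y : EuclideanSpace ℝ (Fin m)}

theorem IsOpenInQuadrant.nhdsWithin_eq (hU : IsOpenInQuadrant U) (hy : y ∈ U) :
    𝓝[U] y = 𝓝[quadrant m] y :=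
  le_antisymm (nhdsWithin_mono _ hU.subset) (nhdsWithin_le_of_mem (hU.mem_nhdsWithin y hy))

theorem IsOpenInQuadrant.inter_ne_zero (hU : IsOpenInQuadrant U) (hf : ContinuousOn f U) :
    IsOpenInQuadrant (U ∩ {x | f x ≠ 0}) where
  subset := Set.inter_subset_left.trans hU.subset
  mem_nhdsWithin y hy := by
    refine inter_mem (hU.mem_nhdsWithin y hy.1) ?_
    rw [← hU.nhdsWithin_eq hy.1]
    exact (hf y hy.1).eventually_ne hy.2

theorem ContDiffOn.contDiffWithinAt_quadrant {n : ℕ∞ω} (hU : IsOpenInQuadrant U)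
    (hf : ContDiffOn ℝ n f U) (hy : y ∈ U) : ContDiffWithinAt ℝ n f (quadrant m) y :=
  (hf y hy).mono_of_mem_nhdsWithin (hU.mem_nhdsWithin y hy)

theorem ContDiffOn.differentiableWithinAt_quadrant (hU : IsOpenInQuadrant U)
    (hf : ContDiffOn ℝ ∞ f U) (hy : y ∈ U) : DifferentiableWithinAt ℝ f (quadrant m) y :=
  (hf.contDiffWithinAt_quadrant hU hy).differentiableWithinAt (by simp)

theorem ContDiffOn.pderiv (hU : IsOpenInQuadrant U) (hf : ContDiffOn ℝ ∞ f U) (i : Fin m) :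
    ContDiffOn ℝ ∞ (pderiv i f) U := by
  intro y hy
  have h : ContDiffWithinAt ℝ ∞ (fderivWithin ℝ f (quadrant m)) (quadrant m) y :=
    (hf.contDiffWithinAt_quadrant hU hy).fderivWithin_right (uniqueDiffOn_quadrant m)
      (by simp) (hU.subset hy)
  exact (h.clm_apply contDiffWithinAt_const).mono hU.subset

theorem pderiv_congr (hy : y ∈ quadrant m) (h : f =ᶠ[𝓝[quadrant m] y] g) (i : Fin m) :
    pderiv i f y = pderiv i g y := by
  unfold pderiv
  rw [h.fderivWithin_eq (h.self_of_nhdsWithin hy)]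

theorem pderiv_congr_on (hU : IsOpenInQuadrant U) (hy : y ∈ U) (h : Set.EqOn f g U) (i : Fin m) :
    pderiv i f y = pderiv i g y :=
  pderiv_congr (hU.subset hy) (eventually_of_mem (hU.mem_nhdsWithin y hy) h) i

theorem pderiv_add (hy : y ∈ quadrant m) (hf : DifferentiableWithinAt ℝ f (quadrant m) y)
    (hg : DifferentiableWithinAt ℝ g (quadrant m) y) (i : Fin m) :
    pderiv i (fun x => f x + g x) y = pderiv i f y + pderiv i g y := by
  unfold pderiv
  rw [fderivWithin_fun_add (uniqueDiffOn_quadrant m y hy) hf hg]; rfl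

theorem pderiv_sub (hy : y ∈ quadrant m) (hf : DifferentiableWithinAt ℝ f (quadrant m) y)
    (hg : DifferentiableWithinAt ℝ g (quadrant m) y) (i : Fin m) :
    pderiv i (fun x => f x - g x) y = pderiv i f y - pderiv i g y := by
  unfold pderiv
  rw [fderivWithin_fun_sub (uniqueDiffOn_quadrant m y hy) hf hg]; rfl

theorem pderiv_mul (hy : y ∈ quadrant m) (hf : DifferentiableWithinAt ℝ f (quadrant m) y)
    (hg : DifferentiableWithinAt ℝ g (quadrant m) y) (i : Fin m) :
    pderiv i (fun x => f x * g x) y = pderiv i f y * g y + f y * pderiv i g y := by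
  unfold pderiv
  rw [fderivWithin_fun_mul (uniqueDiffOn_quadrant m y hy) hf hg]
  simp; ring

theorem pderiv_inv (hy : y ∈ quadrant m) (hf : DifferentiableWithinAt ℝ f (quadrant m) y)
    (h0 : f y ≠ 0) (i : Fin m) :
    pderiv i (fun x => (f x)⁻¹) y = -pderiv i f y / f y ^ 2 := by
  have h := (hasDerivAt_inv h0).comp_hasFDerivWithinAt y hf.hasFDerivWithinAt
  unfold pderiv
  rw [HasFDerivWithinAt.fderivWithin (f := fun x => (f x)⁻¹) h (uniqueDiffOn_quadrant m y hy)]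
  simp; ring

theorem pderiv_const (c : ℝ) (i : Fin m) : pderiv i (fun _ => c) y = 0 := by
  simp [pderiv]

theorem pderiv_sum {ι : Type*} (s : Finset ι) {F : ι → EuclideanSpace ℝ (Fin m) → ℝ}
    (hy : y ∈ quadrant m) (hF : ∀ k ∈ s, DifferentiableWithinAt ℝ (F k) (quadrant m) y)
    (i : Fin m) : pderiv i (fun x => ∑ k ∈ s, F k x) y = ∑ k ∈ s, pderiv i (F k) y := by
  unfold pderiv
  rw [fderivWithin_fun_sum (uniqueDiffOn_quadrant m y hy) hF]
  simp

/-- A partial derivative of `f` is the one-sided derivative of `f` along any curve in the quadrant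
with the corresponding initial velocity. -/
theorem hasDerivWithinAt_comp_curve {s : Set ℝ} {γ : ℝ → EuclideanSpace ℝ (Fin m)} {c : ℝ}
    {i : Fin m} {t : ℝ} (hf : DifferentiableWithinAt ℝ f (quadrant m) (γ t))
    (hγ : HasDerivWithinAt γ (c • EuclideanSpace.single i 1) s t)
    (hs : Set.MapsTo γ s (quadrant m)) :
    HasDerivWithinAt (f ∘ γ) (c * pderiv i f (γ t)) s t := by
  have h := hf.hasFDerivWithinAt.comp_hasDerivWithinAt t hγ hs
  simpa [pderiv] using h

end

section

variable {m : ℕ} {E : Type*} [NormedAddCommGroup E] [NormedSpace ℝ E] {U : Set E}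
  {A : E → Matrix (Fin m) (Fin m) ℝ} {n : ℕ∞ω}

theorem ContDiffOn.matrix_det (hA : ∀ i j, ContDiffOn ℝ n (fun x => A x i j) U) :
    ContDiffOn ℝ n (fun x => (A x).det) U := by
  simp only [Matrix.det_apply]
  refine ContDiffOn.sum fun σ _ => ContDiffOn.const_smul _ ?_
  exact contDiffOn_prod fun i _ => hA _ _

theorem ContDiffOn.matrix_inv (hA : ∀ i j, ContDiffOn ℝ n (fun x => A x i j) U)
    (hdet : ∀ x ∈ U, (A x).det ≠ 0) (i j : Fin m) :
    ContDiffOn ℝ n (fun x => (A x)⁻¹ i j) U := by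
  simp only [Matrix.inv_def, Matrix.smul_apply, smul_eq_mul, Ring.inverse_eq_inv']
  refine ((ContDiffOn.matrix_det hA).inv hdet).mul ?_
  simp only [Matrix.adjugate_apply]
  refine ContDiffOn.matrix_det fun k l => ?_
  by_cases h : k = j
  · subst h; simpa using contDiffOn_const
  · simpa [Matrix.updateRow_ne h] using hA k l

end

section

variable {m : ℕ} {U : Set (EuclideanSpace ℝ (Fin m))}
  {G : EuclideanSpace ℝ (Fin m) → Matrix (Fin m) (Fin m) ℝ}

theorem ContDiffOn.christoffel (hU : IsOpenInQuadrant U)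
    (hG : ∀ i j, ContDiffOn ℝ ∞ (fun x => G x i j) U) (hdet : ∀ x ∈ U, (G x).det ≠ 0)
    (k i j : Fin m) : ContDiffOn ℝ ∞ (christoffel G k i j) U := by
  unfold _root_.christoffel
  refine contDiffOn_const.mul (ContDiffOn.sum fun l _ => ?_)
  exact (ContDiffOn.matrix_inv hG hdet k l).mul
    ((((hG j l).pderiv hU i).add ((hG i l).pderiv hU j)).sub ((hG i j).pderiv hU l))

theorem ContDiffOn.ricci (hU : IsOpenInQuadrant U)
    (hG : ∀ i j, ContDiffOn ℝ ∞ (fun x => G x i j) U) (hdet : ∀ x ∈ U, (G x).det ≠ 0)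
    (i j : Fin m) : ContDiffOn ℝ ∞ (ricci G i j) U := by
  have h := ContDiffOn.christoffel hU hG hdet
  unfold _root_.ricci
  refine ContDiffOn.add (ContDiffOn.sum fun k _ => ?_)
    (ContDiffOn.sum fun k _ => ContDiffOn.sum fun l _ => ?_)
  · exact ((h k i j).pderiv hU k).sub ((h k i k).pderiv hU j)
  · exact ((h _ _ _).mul (h _ _ _)).sub ((h _ _ _).mul (h _ _ _))

theorem christoffel_congr_on {G' : EuclideanSpace ℝ (Fin m) → Matrix (Fin m) (Fin m) ℝ}
    (hU : IsOpenInQuadrant U) {y : EuclideanSpace ℝ (Fin m)} (hy : y ∈ U) (h : Set.EqOn G G' U)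
    (k i j : Fin m) : christoffel G k i j y = christoffel G' k i j y := by
  have h' : ∀ a b c, pderiv c (fun x => G x a b) y = pderiv c (fun x => G' x a b) y :=
    fun a b c => pderiv_congr_on hU hy (fun x hx => by simp only [h hx]) c
  simp only [christoffel, h', h hy]

theorem christoffel_symm (hU : IsOpenInQuadrant U) {y : EuclideanSpace ℝ (Fin m)} (hy : y ∈ U)
    (hs : ∀ x ∈ U, (G x).IsSymm) (k i j : Fin m) :
    christoffel G k i j y = christoffel G k j i y := by
  have h' : ∀ c, pderiv c (fun x => G x i j) y = pderiv c (fun x => G x j i) y :=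
    fun c => pderiv_congr_on hU hy (fun x hx => (hs x hx).apply j i) c
  simp only [christoffel, h']
  congr 1; refine Finset.sum_congr rfl fun l _ => ?_; ring

theorem secondFundForm_eq {y : EuclideanSpace ℝ (Fin m)} (hs : (G y).IsSymm)
    (hdet : (G y).det ≠ 0) (k i j : Fin m) :
    secondFundForm G k i j y = christoffel G k i j y / √((G y)⁻¹ k k) := by
  have h1 : ∀ p, ∑ q, G y p q * (G y)⁻¹ k q = if k = p then 1 else 0 := by
    intro p
    have := congrFun (congrFun (Matrix.nonsing_inv_mul (G y) (Ne.isUnit hdet)) k) p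
    rw [Matrix.mul_apply, Matrix.one_apply] at this
    rw [← this]
    exact Finset.sum_congr rfl fun q _ => by rw [mul_comm, hs.apply]
  unfold secondFundForm coordNormal
  calc _ = ∑ p, (∑ q, G y p q * (G y)⁻¹ k q) * (christoffel G p i j y / √((G y)⁻¹ k k)) := by
        refine Finset.sum_congr rfl fun p _ => ?_
        rw [Finset.sum_mul]
        exact Finset.sum_congr rfl fun q _ => by ring
    _ = _ := by simp [h1]

end

/-! ### Conformal changes of metric -/

theorem Matrix.sum_mul_nonsing_inv {m : ℕ} {A : Matrix (Fin m) (Fin m) ℝ} (hdet : A.det ≠ 0)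
    (p q : Fin m) : ∑ k, A p k * A⁻¹ k q = if p = q then 1 else 0 := by
  have := congrFun (congrFun (Matrix.mul_nonsing_inv A (Ne.isUnit hdet)) p) q
  rwa [Matrix.mul_apply, Matrix.one_apply] at this

theorem Matrix.sum_nonsing_inv_mul {m : ℕ} {A : Matrix (Fin m) (Fin m) ℝ} (hdet : A.det ≠ 0)
    (p q : Fin m) : ∑ k, A⁻¹ p k * A k q = if p = q then 1 else 0 := by
  have := congrFun (congrFun (Matrix.nonsing_inv_mul A (Ne.isUnit hdet)) p) q
  rwa [Matrix.mul_apply, Matrix.one_apply] at this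

theorem Matrix.inv_smul_apply {m : ℕ} {A : Matrix (Fin m) (Fin m) ℝ} (hdet : A.det ≠ 0)
    {c : ℝ} (hc : c ≠ 0) (i j : Fin m) : (c • A)⁻¹ i j = c⁻¹ * A⁻¹ i j := by
  have h : (c • A)⁻¹ = c⁻¹ • A⁻¹ := by
    refine Matrix.inv_eq_right_inv ?_
    rw [Matrix.smul_mul, Matrix.mul_smul, smul_smul, mul_inv_cancel₀ hc, one_smul,
      Matrix.mul_nonsing_inv _ (Ne.isUnit hdet)]
  rw [h]; rfl

section

variable {m : ℕ} {U : Set (EuclideanSpace ℝ (Fin m))}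
  {G : EuclideanSpace ℝ (Fin m) → Matrix (Fin m) (Fin m) ℝ} {u : EuclideanSpace ℝ (Fin m) → ℝ}
  {y : EuclideanSpace ℝ (Fin m)}

/-- Lowering the upper index gives the Christoffel symbols of the first kind. -/
theorem sum_mul_christoffel (hdet : (G y).det ≠ 0) (p i j : Fin m) :
    ∑ k, G y p k * christoffel G k i j y = (1 / 2) * (pderiv i (fun x => G x j p) y
      + pderiv j (fun x => G x i p) y - pderiv p (fun x => G x i j) y) := by
  set D : Fin m → ℝ := fun l => pderiv i (fun x => G x j l) y
      + pderiv j (fun x => G x i l) y - pderiv l (fun x => G x i j) y with hD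
  calc ∑ k, G y p k * christoffel G k i j y
      = ∑ k, ∑ l, (1 / 2) * (G y p k * (G y)⁻¹ k l * D l) := by
        refine Finset.sum_congr rfl fun k _ => ?_
        rw [christoffel, ← mul_assoc, Finset.mul_sum]
        exact Finset.sum_congr rfl fun l _ => by ring
    _ = ∑ l, (1 / 2) * ((∑ k, G y p k * (G y)⁻¹ k l) * D l) := by
        rw [Finset.sum_comm]
        refine Finset.sum_congr rfl fun l _ => ?_
        rw [Finset.sum_mul, Finset.mul_sum]
    _ = _ := by simp [Matrix.sum_mul_nonsing_inv hdet, hD]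

/-- The Levi-Civita connection is compatible with the metric. -/
theorem pderiv_metric (hU : IsOpenInQuadrant U) (hy : y ∈ U) (hs : ∀ x ∈ U, (G x).IsSymm)
    (hdet : (G y).det ≠ 0) (k i j : Fin m) :
    pderiv k (fun x => G x i j) y
      = ∑ l, (G y j l * christoffel G l k i y + G y i l * christoffel G l k j y) := by
  have h' : ∀ a b c, pderiv c (fun x => G x a b) y = pderiv c (fun x => G x b a) y :=
    fun a b c => pderiv_congr_on hU hy (fun x hx => (hs x hx).apply b a) c
  rw [Finset.sum_add_distrib, sum_mul_christoffel hdet, sum_mul_christoffel hdet, h' j i,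
    h' k i, h' k j]
  ring

/-- The change of the Christoffel symbols under the conformal change from `G` to `u G`: the
difference tensor is determined by `d (log u) / 2`. -/
theorem christoffel_smul (hU : IsOpenInQuadrant U) (hy : y ∈ U)
    (hG : ∀ i j, ContDiffOn ℝ ∞ (fun x => G x i j) U) (hs : ∀ x ∈ U, (G x).IsSymm)
    (hdet : (G y).det ≠ 0) (hu : ContDiffOn ℝ ∞ u U) (hu0 : u y ≠ 0) (k i j : Fin m) :
    christoffel (fun x => u x • G x) k i j y = christoffel G k i j y
      + ((if k = j then pderiv i u y / (2 * u y) else 0)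
        + (if k = i then pderiv j u y / (2 * u y) else 0)
        - G y i j * ∑ l, (G y)⁻¹ k l * (pderiv l u y / (2 * u y))) := by
  have hy' := hU.subset hy
  have hp : ∀ a b c, pderiv c (fun x => (u x • G x) a b) y
      = pderiv c u y * G y a b + u y * pderiv c (fun x => G x a b) y := fun a b c =>
    pderiv_mul hy' (hu.differentiableWithinAt_quadrant hU hy)
      ((hG a b).differentiableWithinAt_quadrant hU hy) c
  have e1 : ∀ b, ∑ l, (G y)⁻¹ k l * G y b l = if k = b then 1 else 0 := fun b => by
    rw [← Matrix.sum_nonsing_inv_mul hdet k b]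
    exact Finset.sum_congr rfl fun l _ => by rw [(hs y hy).apply]
  simp only [christoffel, hp, Matrix.inv_smul_apply hdet hu0]
  have : ∑ l, (u y)⁻¹ * (G y)⁻¹ k l * (pderiv i u y * G y j l + u y * pderiv i (fun x => G x j l) y
      + (pderiv j u y * G y i l + u y * pderiv j (fun x => G x i l) y)
      - (pderiv l u y * G y i j + u y * pderiv l (fun x => G x i j) y))
    = (∑ l, (G y)⁻¹ k l * (pderiv i (fun x => G x j l) y + pderiv j (fun x => G x i l) y
        - pderiv l (fun x => G x i j) y))
      + (u y)⁻¹ * pderiv i u y * (∑ l, (G y)⁻¹ k l * G y j l)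
      + (u y)⁻¹ * pderiv j u y * (∑ l, (G y)⁻¹ k l * G y i l)
      - 2 * G y i j * ∑ l, (G y)⁻¹ k l * (pderiv l u y / (2 * u y)) := by
    simp only [Finset.mul_sum, ← Finset.sum_add_distrib, ← Finset.sum_sub_distrib]
    refine Finset.sum_congr rfl fun l _ => ?_
    field_simp
    ring
  rw [this, e1, e1]
  split_ifs <;> field_simp <;> ring

/-- The algebra behind the conformal change of the Ricci tensor. Here `Γ` stands for the Christoffel
symbols of the metric `A`, `f` for a covector with `f_i = A_il F^l`, and
`T^k_ij = δ^k_j f_i + δ^k_i f_j - A_ij F^k` for the difference of the Christoffel symbols. -/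
theorem sum_conformal_difference (A : Matrix (Fin m) (Fin m) ℝ) (hA : A.IsSymm)
    (Γ : Fin m → Fin m → Fin m → ℝ) (hΓ : ∀ k i j, Γ k i j = Γ k j i) (f F : Fin m → ℝ)
    (hf : ∀ i, ∑ l, A i l * F l = f i) (T : Fin m → Fin m → Fin m → ℝ)
    (hT : ∀ k i j, T k i j = (if k = j then f i else 0) + (if k = i then f j else 0)
      - A i j * F k) (i j : Fin m) :
    ∑ k, ∑ l, ((Γ k k l + T k k l) * (Γ l i j + T l i j)
        - (Γ k j l + T k j l) * (Γ l i k + T l i k))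
      = ∑ k, ∑ l, (Γ k k l * Γ l i j - Γ k j l * Γ l i k)
        + (m - 2) * ∑ l, f l * Γ l i j + (m - 2) * (f i * f j)
        + ∑ k, (∑ l, (A j l * Γ l k i + A i l * Γ l k j)) * F k
        + (2 * (∑ l, f l * F l) - m * (∑ l, f l * F l) - ∑ k, ∑ l, Γ k k l * F l) * A i j := by
  have trT : ∀ l, ∑ k, T k k l = m * f l := by
    intro l
    have : ∀ k, A k l * F k = A l k * F k := fun k => by rw [hA.apply]
    simp only [hT, Finset.sum_sub_distrib, Finset.sum_add_distrib, this, hf]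
    simp
  have A1 : ∑ k, ∑ l, Γ k k l * T l i j = (∑ k, Γ k k j) * f i + (∑ k, Γ k k i) * f j
      - A i j * ∑ k, ∑ l, Γ k k l * F l := by
    simp only [hT, mul_sub, mul_add, Finset.sum_sub_distrib, Finset.sum_add_distrib, mul_ite,
      mul_zero, Finset.sum_ite_eq', Finset.mem_univ, if_true, Finset.sum_mul, Finset.mul_sum]
    congr 1
    exact Finset.sum_congr rfl fun k _ => Finset.sum_congr rfl fun l _ => by ring
  have A2 : ∀ X : Fin m → ℝ, ∑ k, ∑ l, T k k l * X l = m * ∑ l, f l * X l := by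
    intro X
    rw [Finset.sum_comm, Finset.mul_sum]
    exact Finset.sum_congr rfl fun l _ => by rw [← Finset.sum_mul, trT]; ring
  have A2' : ∑ l, f l * T l i j = 2 * (f i * f j) - A i j * ∑ l, f l * F l := by
    simp only [hT, mul_sub, mul_add, Finset.sum_sub_distrib, Finset.sum_add_distrib, mul_ite,
      mul_zero, Finset.sum_ite_eq', Finset.mem_univ, if_true, Finset.mul_sum]
    rw [show f j * f i + f i * f j = 2 * (f i * f j) by ring]
    congr 1
    exact Finset.sum_congr rfl fun k _ => by ring
  have A3 : ∑ k, ∑ l, Γ k j l * T l i k = (∑ k, Γ k j k) * f i + (∑ k, f k * Γ k j i)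
      - ∑ k, ∑ l, A i k * Γ k l j * F l := by
    simp only [hT, mul_sub, mul_add, Finset.sum_sub_distrib, Finset.sum_add_distrib, mul_ite,
      mul_zero, Finset.sum_ite_eq', Finset.mem_univ, if_true, Finset.sum_mul]
    congr 1
    · congr 1
      exact Finset.sum_congr rfl fun k _ => by ring
    · exact Finset.sum_congr rfl fun k _ => Finset.sum_congr rfl fun l _ => by rw [hΓ k j l]; ring
  have A4 : ∑ k, ∑ l, T k j l * Γ l i k = (∑ k, Γ k i k) * f j + (∑ l, f l * Γ l i j)
      - ∑ k, ∑ l, A j l * Γ l k i * F k := by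
    simp only [hT, sub_mul, add_mul, Finset.sum_sub_distrib, Finset.sum_add_distrib, ite_mul,
      zero_mul, Finset.sum_ite_eq, Finset.mem_univ, if_true, Finset.sum_mul]
    congr 1
    · congr 1
      · exact Finset.sum_congr rfl fun k _ => by ring
      · rw [Finset.sum_comm]
        simp
    · exact Finset.sum_congr rfl fun k _ => Finset.sum_congr rfl fun l _ => by rw [hΓ l i k]; ring
  have A5 : ∑ k, ∑ l, T k j l * T l i k = (m + 2) * (f i * f j)
      - 2 * (A i j * ∑ l, f l * F l) := by
    have B1 : ∑ k, ∑ l, T k j l * T l i k = (∑ k, f j * T k i k) + (∑ l, f l * T l i j)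
        - ∑ l, A j l * ∑ k, F k * T l i k := by
      simp only [hT _ j, sub_mul, add_mul, Finset.sum_sub_distrib, Finset.sum_add_distrib, ite_mul,
        zero_mul, Finset.sum_ite_eq, Finset.mem_univ, if_true]
      congr 1
      · congr 1
        rw [Finset.sum_comm]
        simp
      · rw [Finset.sum_comm]
        refine Finset.sum_congr rfl fun l _ => ?_
        rw [Finset.mul_sum]
        exact Finset.sum_congr rfl fun k _ => by ring
    have B2 : ∑ k, T k i k = m * f i := by
      rw [← trT]
      refine Finset.sum_congr rfl fun k _ => ?_
      simp only [hT, hA.apply i k]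
      ring
    have B3 : ∀ l, ∑ k, F k * T l i k = F l * f i + (if l = i then ∑ k, f k * F k else 0)
        - f i * F l := by
      intro l
      simp only [hT, mul_sub, mul_add, Finset.sum_sub_distrib, Finset.sum_add_distrib, mul_ite,
        mul_zero, Finset.sum_ite_eq, Finset.mem_univ, if_true]
      congr 1
      · congr 1
        split_ifs
        · exact Finset.sum_congr rfl fun k _ => by ring
        · simp
      · rw [← hf i, Finset.sum_mul]
        exact Finset.sum_congr rfl fun k _ => by ring
    have B4 : ∑ l, A j l * ∑ k, F k * T l i k = A i j * ∑ k, f k * F k := by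
      simp only [B3]
      calc _ = ∑ l, (if l = i then A j l * ∑ k, f k * F k else 0) :=
            Finset.sum_congr rfl fun l _ => by split_ifs <;> ring
        _ = _ := by simp [hA.apply i j]
    rw [B1, ← Finset.mul_sum, B2, A2', B4]
    ring
  have split : ∑ k, ∑ l, ((Γ k k l + T k k l) * (Γ l i j + T l i j)
        - (Γ k j l + T k j l) * (Γ l i k + T l i k))
      = ∑ k, ∑ l, (Γ k k l * Γ l i j - Γ k j l * Γ l i k)
        + ∑ k, ∑ l, Γ k k l * T l i j + ∑ k, ∑ l, T k k l * Γ l i j + ∑ k, ∑ l, T k k l * T l i j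
        - ∑ k, ∑ l, Γ k j l * T l i k - ∑ k, ∑ l, T k j l * Γ l i k
        - ∑ k, ∑ l, T k j l * T l i k := by
    simp only [← Finset.sum_add_distrib, ← Finset.sum_sub_distrib]
    exact Finset.sum_congr rfl fun k _ => Finset.sum_congr rfl fun l _ => by ring
  have C1 : ∑ k, (∑ l, (A j l * Γ l k i + A i l * Γ l k j)) * F k
      = ∑ k, ∑ l, A j l * Γ l k i * F k + ∑ k, ∑ l, A i k * Γ k l j * F l := by
    rw [Finset.sum_comm (f := fun k l => A i k * Γ k l j * F l), ← Finset.sum_add_distrib]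
    refine Finset.sum_congr rfl fun k _ => ?_
    rw [Finset.sum_mul, ← Finset.sum_add_distrib]
    exact Finset.sum_congr rfl fun l _ => by ring
  have D1 : ∑ k, Γ k j k = ∑ k, Γ k k j := Finset.sum_congr rfl fun k _ => hΓ _ _ _
  have D2 : ∑ k, Γ k i k = ∑ k, Γ k k i := Finset.sum_congr rfl fun k _ => hΓ _ _ _
  have D3 : ∑ k, f k * Γ k j i = ∑ k, f k * Γ k i j :=
    Finset.sum_congr rfl fun k _ => by rw [hΓ]
  rw [split, A1, A2, A2, A2', A3, A4, A5, C1, D1, D2, D3]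
  ring

/-- The change of the Ricci tensor under the conformal change from `G` to `u G`, up to a multiple
of `G`. Writing `f` for `d (log u) / 2`, the rest is `-(m - 2) (∇ f - f ⊗ f)`; the two mixed partial
derivatives are kept apart, so that their equality is not needed. -/
theorem exists_ricci_smul (hU : IsOpenInQuadrant U) (hy : y ∈ U)
    (hG : ∀ i j, ContDiffOn ℝ ∞ (fun x => G x i j) U) (hs : ∀ x ∈ U, (G x).IsSymm)
    (hdet : ∀ x ∈ U, (G x).det ≠ 0) (hu : ContDiffOn ℝ ∞ u U) (hu0 : ∀ x ∈ U, u x ≠ 0)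
    (f : Fin m → EuclideanSpace ℝ (Fin m) → ℝ) (hf : ∀ i x, f i x = pderiv i u x / (2 * u x)) :
    ∃ s : ℝ, ∀ i j, ricci (fun x => u x • G x) i j y = ricci G i j y
      + pderiv i (f j) y - (m - 1) * pderiv j (f i) y
      + (m - 2) * ∑ l, f l y * christoffel G l i j y + (m - 2) * (f i y * f j y)
      + s * G y i j := by
  have hy' := hU.subset hy
  have hf' : ∀ i, ContDiffOn ℝ ∞ (f i) U := fun i => by
    rw [show f i = fun x => pderiv i u x / (2 * u x) from funext (hf i)]
    exact (hu.pderiv hU i).div (contDiffOn_const.mul hu)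
      fun x hx => mul_ne_zero two_ne_zero (hu0 x hx)
  set F : Fin m → EuclideanSpace ℝ (Fin m) → ℝ := fun k x => ∑ l, (G x)⁻¹ k l * f l x with hF
  have hF' : ∀ k, ContDiffOn ℝ ∞ (F k) U := fun k =>
    ContDiffOn.sum fun l _ => (ContDiffOn.matrix_inv hG hdet k l).mul (hf' l)
  have hlow : ∀ x ∈ U, ∀ i, ∑ l, G x i l * F l x = f i x := fun x hx i => by
    simp only [hF, Finset.mul_sum]
    rw [Finset.sum_comm]
    simp only [← mul_assoc, ← Finset.sum_mul, Matrix.sum_mul_nonsing_inv (hdet x hx)]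
    simp
  set T : Fin m → Fin m → Fin m → EuclideanSpace ℝ (Fin m) → ℝ := fun k i j x =>
    (if k = j then f i x else 0) + (if k = i then f j x else 0) - G x i j * F k x with hT
  have hT1 : ∀ k i j, ContDiffOn ℝ ∞ (fun x => (if k = j then f i x else 0)
      + (if k = i then f j x else 0)) U := fun k i j => by
    refine ContDiffOn.add ?_ ?_ <;> split_ifs
    exacts [hf' _, contDiffOn_const, hf' _, contDiffOn_const]
  have hT2 : ∀ k i j, ContDiffOn ℝ ∞ (fun x => G x i j * F k x) U := fun k i j =>
    (hG i j).mul (hF' k)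
  have hT' : ∀ k i j, ContDiffOn ℝ ∞ (T k i j) U := fun k i j => (hT1 k i j).sub (hT2 k i j)
  have hC := ContDiffOn.christoffel hU hG hdet
  have key : ∀ k i j, Set.EqOn (christoffel (fun x => u x • G x) k i j)
      (fun x => christoffel G k i j x + T k i j x) U := fun k i j x hx => by
    simp only [hT, hF, hf]
    exact christoffel_smul hU hx hG hs (hdet x hx) hu (hu0 x hx) k i j
  have hd : ∀ k i j c, pderiv c (christoffel (fun x => u x • G x) k i j) y
      = pderiv c (christoffel G k i j) y + pderiv c (T k i j) y := fun k i j c => by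
    rw [pderiv_congr_on hU hy (key k i j)]
    exact pderiv_add hy' ((hC k i j).differentiableWithinAt_quadrant hU hy)
      ((hT' k i j).differentiableWithinAt_quadrant hU hy) c
  have hdT : ∀ k i j c, pderiv c (T k i j) y = (if k = j then pderiv c (f i) y else 0)
      + (if k = i then pderiv c (f j) y else 0)
      - (pderiv c (fun x => G x i j) y * F k y + G y i j * pderiv c (F k) y) := fun k i j c => by
    rw [hT]
    rw [pderiv_sub hy' ((hT1 k i j).differentiableWithinAt_quadrant hU hy)
      ((hT2 k i j).differentiableWithinAt_quadrant hU hy), pderiv_mul hy'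
      ((hG i j).differentiableWithinAt_quadrant hU hy)
      ((hF' k).differentiableWithinAt_quadrant hU hy)]
    congr 1
    rw [pderiv_add hy']
    · congr 1 <;> split_ifs <;> first | rfl | exact pderiv_const 0 c
    · split_ifs
      exacts [(hf' _).differentiableWithinAt_quadrant hU hy, differentiableWithinAt_const 0]
    · split_ifs
      exacts [(hf' _).differentiableWithinAt_quadrant hU hy, differentiableWithinAt_const 0]
  have htr : ∀ i j, ∑ k, pderiv j (T k i k) y = m * pderiv j (f i) y := fun i j => by
    rw [← pderiv_sum _ hy' fun k _ => (hT' k i k).differentiableWithinAt_quadrant hU hy]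
    rw [pderiv_congr_on hU hy (g := fun x => m * f i x), pderiv_mul hy'
      (differentiableWithinAt_const _) ((hf' i).differentiableWithinAt_quadrant hU hy),
      pderiv_const]
    · ring
    · intro x hx
      simp only [hT, Finset.sum_sub_distrib, Finset.sum_add_distrib, hlow x hx]
      simp
  have hdiv : ∀ i j, ∑ k, pderiv k (T k i j) y = pderiv j (f i) y + pderiv i (f j) y
      - ∑ k, pderiv k (fun x => G x i j) y * F k y - (∑ k, pderiv k (F k) y) * G y i j :=
    fun i j => by
      simp only [hdT, Finset.sum_sub_distrib, Finset.sum_add_distrib, Finset.sum_mul]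
      simp only [Finset.sum_ite_eq', Finset.mem_univ, if_true, mul_comm (G y i j)]
      ring
  refine ⟨2 * (∑ l, f l y * F l y) - m * (∑ l, f l y * F l y)
    - ∑ k, ∑ l, christoffel G k k l y * F l y - ∑ k, pderiv k (F k) y, fun i j => ?_⟩
  have alg := sum_conformal_difference (G y) (hs y hy) (fun k i j => christoffel G k i j y)
    (christoffel_symm hU hy hs) (fun i => f i y) (fun i => F i y) (hlow y hy)
    (fun k i j => T k i j y) (fun k i j => rfl) i j
  have hmet := pderiv_metric hU hy hs (hdet y hy)
  unfold ricci
  simp only [key _ _ _ hy, hd] at alg ⊢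
  rw [alg]
  simp only [Finset.sum_sub_distrib, Finset.sum_add_distrib] at htr hdiv hmet ⊢
  rw [htr, hdiv]
  simp only [hmet]
  ring

end

/-! ### Tensor fields in charts -/

section

variable {d : ℕ} {X : Type*} [TopologicalSpace X]
  {e : OpenPartialHomeomorph X (EuclideanQuadrant (d + 2))}
  {y : EuclideanSpace ℝ (Fin (d + 2))}

theorem range_cornerModel : Set.range (cornerModel d) = quadrant (d + 2) :=
  range_euclideanQuadrant (d + 2)

theorem isOpenInQuadrant_target (e : OpenPartialHomeomorph X (EuclideanQuadrant (d + 2))) :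
    IsOpenInQuadrant (e.extend (cornerModel d)).target where
  subset := by
    rw [← range_cornerModel, e.extend_target]
    exact Set.inter_subset_right
  mem_nhdsWithin y hy := by
    rw [← range_cornerModel]
    have h := e.extend_target_mem_nhdsWithin (I := cornerModel d)
      (by simpa using (e.extend (cornerModel d)).map_target hy)
    have h' : e.extend (cornerModel d) (e.symm ((cornerModel d).symm y)) = y :=
      (e.extend (cornerModel d)).right_inv hy
    rwa [h'] at h

theorem extend_symm_mem_source (hy : y ∈ (e.extend (cornerModel d)).target) :
    (e.extend (cornerModel d)).symm y ∈ e.source := by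
  rw [← e.extend_source (I := cornerModel d)]
  exact (e.extend (cornerModel d)).map_target hy

theorem uniqueMDiffWithinAt_range (hy : y ∈ (e.extend (cornerModel d)).target) :
    UniqueMDiffWithinAt 𝓘(ℝ, EuclideanSpace ℝ (Fin (d + 2))) (Set.range (cornerModel d)) y := by
  rw [range_cornerModel]
  exact (uniqueDiffOn_quadrant _ y
    ((isOpenInQuadrant_target e).subset hy)).uniqueMDiffWithinAt

variable [ChartedSpace (EuclideanQuadrant (d + 2)) X]

namespace IsAdaptedChart

variable {M Q : Set X}

theorem symm_mem_M_iff (he : IsAdaptedChart M Q e) (hy : y ∈ (e.extend (cornerModel d)).target) :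
    (e.extend (cornerModel d)).symm y ∈ M ↔ y 0 = 0 := by
  rw [he.mem_M_iff _ (extend_symm_mem_source hy)]
  have h := (e.extend (cornerModel d)).right_inv hy
  exact ⟨fun h' => by rw [← h]; exact h', fun h' => by rw [← h] at h'; exact h'⟩

theorem symm_mem_Q_iff (he : IsAdaptedChart M Q e) (hy : y ∈ (e.extend (cornerModel d)).target) :
    (e.extend (cornerModel d)).symm y ∈ Q ↔ y (Fin.last (d + 1)) = 0 := by
  rw [he.mem_Q_iff _ (extend_symm_mem_source hy)]
  have h := (e.extend (cornerModel d)).right_inv hy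
  exact ⟨fun h' => by rw [← h]; exact h', fun h' => by rw [← h] at h'; exact h'⟩

theorem pos_of_mem_target (he : IsAdaptedChart M Q e)
    (hy : y ∈ (e.extend (cornerModel d)).target) (i : Fin (d + 2)) (hi : i ≠ 0)
    (hi' : i ≠ Fin.last (d + 1)) : 0 < y i := by
  have h := (e.extend (cornerModel d)).right_inv hy
  rw [← h]
  exact he.pos _ (extend_symm_mem_source hy) i hi hi'

end IsAdaptedChart

/-- The coordinate frame of `e` at the point with coordinates `y`, as a linear map. -/
noncomputable abbrev chartFrame (e : OpenPartialHomeomorph X (EuclideanQuadrant (d + 2)))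
    (y : EuclideanSpace ℝ (Fin (d + 2))) :
    EuclideanSpace ℝ (Fin (d + 2)) →L[ℝ]
      TangentSpace (cornerModel d) ((e.extend (cornerModel d)).symm y) :=
  mfderivWithin 𝓘(ℝ, EuclideanSpace ℝ (Fin (d + 2))) (cornerModel d)
      (e.extend (cornerModel d)).symm (Set.range (cornerModel d)) y

theorem chartForm_eq_sum (T : BilinField d X) (v w : EuclideanSpace ℝ (Fin (d + 2))) :
    chartForm e T y v w = ∑ i, ∑ j, v i * w j * chartComponents e T y i j := by
  set b : LinearMap.BilinForm ℝ (EuclideanSpace ℝ (Fin (d + 2))) :=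
    LinearMap.mk₂ ℝ (fun v w => T _ (chartFrame e y v) (chartFrame e y w))
      (fun _ _ _ => by simp only [map_add]; rfl) (fun _ _ _ => by simp only [map_smul]; rfl)
      (fun _ _ _ => by simp only [map_add]) (fun _ _ _ => by simp only [map_smul]) with hb
  have h : b v w = ∑ i, ∑ j, v i * w j * b (EuclideanSpace.single i 1)
      (EuclideanSpace.single j 1) := by
    rw [← LinearMap.sum_repr_mul_repr_mul (EuclideanSpace.basisFun (Fin (d + 2)) ℝ).toBasis
      (EuclideanSpace.basisFun (Fin (d + 2)) ℝ).toBasis]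
    rw [Finsupp.sum_fintype _ _ (by simp)]
    refine Finset.sum_congr rfl fun i _ => ?_
    rw [Finsupp.sum_fintype _ _ (by simp)]
    refine Finset.sum_congr rfl fun j _ => ?_
    simp [mul_assoc]
  exact h

theorem chartForm_eq_dotProduct (T : BilinField d X) (v w : EuclideanSpace ℝ (Fin (d + 2))) :
    chartForm e T y v w = v.ofLp ⬝ᵥ (chartComponents e T y).mulVec w.ofLp := by
  rw [chartForm_eq_sum]
  simp only [dotProduct, Matrix.mulVec, Finset.mul_sum]
  exact Finset.sum_congr rfl fun i _ => Finset.sum_congr rfl fun j _ => by ring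

theorem mdifferentiableAt_chart (he : e ∈ IsManifold.maximalAtlas (cornerModel d) ∞ X)
    {x : X} (hx : x ∈ e.source) :
    MDifferentiableAt (cornerModel d) 𝓘(ℝ, EuclideanSpace ℝ (Fin (d + 2)))
      (e.extend (cornerModel d)) x :=
  (e.contMDiffAt_extend he hx).mdifferentiableAt (by simp)

theorem contMDiffOn_extend_symm_target (he : e ∈ IsManifold.maximalAtlas (cornerModel d) ∞ X) :
    ContMDiffOn 𝓘(ℝ, EuclideanSpace ℝ (Fin (d + 2))) (cornerModel d) ∞
      (e.extend (cornerModel d)).symm (e.extend (cornerModel d)).target := by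
  rw [e.extend_target']
  exact contMDiffOn_extend_symm he

theorem mdifferentiableWithinAt_chart_symm
    (he : e ∈ IsManifold.maximalAtlas (cornerModel d) ∞ X)
    (hy : y ∈ (e.extend (cornerModel d)).target) :
    MDifferentiableWithinAt 𝓘(ℝ, EuclideanSpace ℝ (Fin (d + 2))) (cornerModel d)
      (e.extend (cornerModel d)).symm (Set.range (cornerModel d)) y := by
  have h := (contMDiffOn_extend_symm_target he y hy).mdifferentiableWithinAt (by simp)
  refine h.mono_of_mem_nhdsWithin ?_
  rw [range_cornerModel]
  exact (isOpenInQuadrant_target e).mem_nhdsWithin y hy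

theorem chartFrame_injective (he : e ∈ IsManifold.maximalAtlas (cornerModel d) ∞ X)
    (hy : y ∈ (e.extend (cornerModel d)).target) : Function.Injective (chartFrame e y) := by
  have hx := extend_symm_mem_source hy
  have h1 := mdifferentiableWithinAt_chart_symm he hy
  have h2 := mdifferentiableAt_chart he hx
  have h3 := mfderiv_comp_mfderivWithin y h2 h1 (uniqueMDiffWithinAt_range hy)
  have h4 : mfderivWithin 𝓘(ℝ, EuclideanSpace ℝ (Fin (d + 2)))
      𝓘(ℝ, EuclideanSpace ℝ (Fin (d + 2)))
      (e.extend (cornerModel d) ∘ (e.extend (cornerModel d)).symm) (Set.range (cornerModel d)) y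
      = ContinuousLinearMap.id ℝ _ := by
    rw [← mfderivWithin_id (uniqueMDiffWithinAt_range hy)]
    refine Filter.EventuallyEq.mfderivWithin_eq ?_ ((e.extend (cornerModel d)).right_inv hy)
    rw [range_cornerModel]
    filter_upwards [(isOpenInQuadrant_target e).mem_nhdsWithin y hy] with z hz
    exact (e.extend (cornerModel d)).right_inv hz
  intro v w hvw
  have h5 := congrArg (fun L => L v) (h4.symm.trans h3)
  have h6 := congrArg (fun L => L w) (h4.symm.trans h3)
  change v = _ at h5
  change w = _ at h6
  rw [h5, h6]
  exact congrArg (mfderiv (cornerModel d) 𝓘(ℝ, EuclideanSpace ℝ (Fin (d + 2)))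
    (e.extend (cornerModel d)) _) hvw

theorem chartFrame_surjective (he : e ∈ IsManifold.maximalAtlas (cornerModel d) ∞ X)
    (hy : y ∈ (e.extend (cornerModel d)).target) : Function.Surjective (chartFrame e y) := by
  have h := chartFrame_injective he hy
  let L : EuclideanSpace ℝ (Fin (d + 2)) →ₗ[ℝ] EuclideanSpace ℝ (Fin (d + 2)) :=
    (chartFrame e y).toLinearMap
  exact LinearMap.surjective_of_injective (f := L) h

variable [IsManifold (cornerModel d) ∞ X]

/-- The components of a tensor field in a smooth chart are as regular as the field. -/
theorem contDiffOn_chartComponents (he : e ∈ IsManifold.maximalAtlas (cornerModel d) ∞ X)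
    {n : ℕ∞ω} (hn : n + 1 ≤ ∞) {T : BilinField d X} {s : Set X}
    (hT : ContMDiffOn (cornerModel d)
      ((cornerModel d).prod 𝓘(ℝ, EuclideanSpace ℝ (Fin (d + 2)) →L[ℝ]
        EuclideanSpace ℝ (Fin (d + 2)) →L[ℝ] ℝ)) n
      (fun x => TotalSpace.mk' (EuclideanSpace ℝ (Fin (d + 2)) →L[ℝ]
        EuclideanSpace ℝ (Fin (d + 2)) →L[ℝ] ℝ)
        (E := fun x : X => TangentSpace (cornerModel d) x →L[ℝ]
          TangentSpace (cornerModel d) x →L[ℝ] ℝ) x (T x)) s) (i j : Fin (d + 2)) :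
    ContDiffOn ℝ n (fun y => chartComponents e T y i j)
      ((e.extend (cornerModel d)).target ∩ (e.extend (cornerModel d)).symm ⁻¹' s) := by
  have hn' : n ≤ ∞ := le_trans le_self_add hn
  set U := (e.extend (cornerModel d)).target
  have hU := isOpenInQuadrant_target (d := d) e
  have hUd : UniqueMDiffOn 𝓘(ℝ, EuclideanSpace ℝ (Fin (d + 2))) U := fun y hy =>
    ((uniqueDiffOn_quadrant _ y (hU.subset hy)).mono_nhds
      (hU.nhdsWithin_eq hy).ge).uniqueMDiffWithinAt
  have hv : ∀ v : EuclideanSpace ℝ (Fin (d + 2)), ContMDiffOn 𝓘(ℝ, EuclideanSpace ℝ (Fin (d + 2)))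
      (cornerModel d).tangent n (fun y => (TotalSpace.mk' (EuclideanSpace ℝ (Fin (d + 2)))
        ((e.extend (cornerModel d)).symm y) (chartFrame e y v) :
        TangentBundle (cornerModel d) X)) U := by
    intro v
    have h1 := (contMDiffOn_extend_symm_target he).contMDiffOn_tangentMapWithin hn hUd
    have h2 : ContMDiff 𝓘(ℝ, EuclideanSpace ℝ (Fin (d + 2)))
        𝓘(ℝ, EuclideanSpace ℝ (Fin (d + 2))).tangent n
        (fun y => (⟨y, v⟩ : TangentBundle 𝓘(ℝ, EuclideanSpace ℝ (Fin (d + 2)))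
          (EuclideanSpace ℝ (Fin (d + 2))))) := by
      intro y
      rw [contMDiffAt_totalSpace]
      refine ⟨contMDiffAt_id, ?_⟩
      simpa using contMDiffAt_const
    refine (h1.comp h2.contMDiffOn (s := U) fun y hy => hy).congr fun y hy => ?_
    simp only [Function.comp, tangentMapWithin, chartFrame]
    congr 2
    refine (mfderivWithin_congr_set ?_).symm
    rw [range_cornerModel]
    exact nhdsWithin_eq_iff_eventuallyEq.1 (hU.nhdsWithin_eq hy)
  intro y hy
  rw [← contMDiffWithinAt_iff_contDiffWithinAt]
  have hb : ContMDiffWithinAt 𝓘(ℝ, EuclideanSpace ℝ (Fin (d + 2))) (cornerModel d) n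
      (e.extend (cornerModel d)).symm (U ∩ (e.extend (cornerModel d)).symm ⁻¹' s) y :=
    ((contMDiffOn_extend_symm_target he y hy.1).of_le hn').mono Set.inter_subset_left
  have : ContMDiffWithinAt 𝓘(ℝ, EuclideanSpace ℝ (Fin (d + 2))) ((cornerModel d).prod 𝓘(ℝ)) n
      (fun y ↦ TotalSpace.mk' ℝ (E := Bundle.Trivial X ℝ) ((e.extend (cornerModel d)).symm y)
        (T _ (chartFrame e y (EuclideanSpace.single i 1))
          (chartFrame e y (EuclideanSpace.single j 1))))
      (U ∩ (e.extend (cornerModel d)).symm ⁻¹' s) y := by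
    apply ContMDiffWithinAt.clm_bundle_apply₂ (F₁ := EuclideanSpace ℝ (Fin (d + 2)))
      (F₂ := EuclideanSpace ℝ (Fin (d + 2)))
    · exact (hT _ hy.2).comp y hb Set.inter_subset_right
    · exact (hv _ y hy.1).mono Set.inter_subset_left
    · exact (hv _ y hy.1).mono Set.inter_subset_left
  simp only [contMDiffWithinAt_totalSpace] at this
  exact this.2

end

/-! ### Metrics and defining functions in charts -/

section

variable {m : ℕ} {U : Set (EuclideanSpace ℝ (Fin m))} {f : EuclideanSpace ℝ (Fin m) → ℝ}
  {y : EuclideanSpace ℝ (Fin m)}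

theorem single_nonneg_add_mem_quadrant (hy : y ∈ quadrant m) (k : Fin m) {s : ℝ} (hs : 0 ≤ s) :
    y + s • EuclideanSpace.single k 1 ∈ quadrant m := by
  intro i
  have : 0 ≤ (EuclideanSpace.single k (1 : ℝ) : EuclideanSpace ℝ (Fin m)) i := by
    simp only [PiLp.single_apply]
    split_ifs <;> norm_num
  simpa using add_nonneg (hy i) (mul_nonneg hs this)

theorem tendsto_add_smul_single (hy : y ∈ quadrant m) (k : Fin m) :
    Tendsto (fun s : ℝ => y + s • EuclideanSpace.single k (1 : ℝ)) (𝓝[≥] 0)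
      (𝓝[quadrant m] y) := by
  refine tendsto_nhdsWithin_iff.2 ⟨?_, ?_⟩
  · have : Continuous fun s : ℝ => y + s • EuclideanSpace.single k (1 : ℝ) := by fun_prop
    simpa using (this.tendsto 0).mono_left nhdsWithin_le_nhds
  · filter_upwards [self_mem_nhdsWithin] with s hs
    exact single_nonneg_add_mem_quadrant hy k hs

theorem hasDerivWithinAt_comp_add_smul_single (hy : y ∈ quadrant m)
    (hf : DifferentiableWithinAt ℝ f (quadrant m) y) (k : Fin m) :
    HasDerivWithinAt (fun s : ℝ => f (y + s • EuclideanSpace.single k (1 : ℝ)))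
      (pderiv k f y) (Set.Ici 0) 0 := by
  have h : HasDerivWithinAt (fun s : ℝ => y + s • EuclideanSpace.single k (1 : ℝ))
      ((1 : ℝ) • EuclideanSpace.single k (1 : ℝ)) (Set.Ici 0) 0 :=
    ((hasDerivAt_id (0 : ℝ)).smul_const _ |>.const_add y).hasDerivWithinAt
  have h' := hasDerivWithinAt_comp_curve (f := f) (i := k) (by simpa using hf) h
    fun s hs => single_nonneg_add_mem_quadrant hy k hs
  simpa [Function.comp_def] using h'

/-- The derivatives of a function that vanishes on a face vanish in the directions of that face. -/
theorem pderiv_eq_zero_of_eqOn_face (hU : IsOpenInQuadrant U) (hy : y ∈ U)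
    (hf : DifferentiableWithinAt ℝ f (quadrant m) y) {a k : Fin m} (hk : k ≠ a) (hya : y a = 0)
    (h0 : ∀ x ∈ U, x a = 0 → f x = 0) : pderiv k f y = 0 := by
  have h1 := hasDerivWithinAt_comp_add_smul_single (hU.subset hy) hf k
  have h2 : HasDerivWithinAt (fun s : ℝ => f (y + s • EuclideanSpace.single k (1 : ℝ)))
      0 (Set.Ici 0) 0 := by
    refine (hasDerivWithinAt_const (0 : ℝ) (Set.Ici 0) (0 : ℝ)).congr_of_eventuallyEq ?_ ?_
    · filter_upwards [(tendsto_add_smul_single (hU.subset hy) k).eventually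
        (hU.mem_nhdsWithin y hy)] with s hs
      exact h0 _ hs (by simp [hya, hk.symm])
    · exact h0 _ (by simpa using hy) (by simp [hya])
  exact (uniqueDiffOn_Ici 0 0 Set.self_mem_Ici).eq_deriv _ h1 h2

end

section

variable {d : ℕ} {X : Type*} [TopologicalSpace X] [ChartedSpace (EuclideanQuadrant (d + 2)) X]
  {e : OpenPartialHomeomorph X (EuclideanQuadrant (d + 2))} {M Q : Set X}
  {y : EuclideanSpace ℝ (Fin (d + 2))}

theorem posDef_chartComponents (he : e ∈ IsManifold.maximalAtlas (cornerModel d) ∞ X)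
    (hy : y ∈ (e.extend (cornerModel d)).target) {T : BilinField d X}
    (hs : ∀ v w, T ((e.extend (cornerModel d)).symm y) v w
      = T ((e.extend (cornerModel d)).symm y) w v)
    (hp : ∀ v, v ≠ 0 → 0 < T ((e.extend (cornerModel d)).symm y) v v) :
    (chartComponents e T y).PosDef := by
  refine Matrix.PosDef.of_dotProduct_mulVec_pos ?_ fun x hx => ?_
  · ext i j
    exact hs _ _
  · have h := chartForm_eq_dotProduct (e := e) (y := y) T (WithLp.toLp 2 x) (WithLp.toLp 2 x)
    simp only [star_trivial]
    rw [← h]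
    refine hp _ fun h0 => hx ?_
    have h1 : WithLp.toLp 2 x = (0 : EuclideanSpace ℝ (Fin (d + 2))) :=
      chartFrame_injective he hy (h0.trans (map_zero (chartFrame e y)).symm)
    simpa using congrArg WithLp.ofLp h1

theorem IsDefiningFunction.contDiffOn_chart {φ : X → ℝ} (hφ : IsDefiningFunction (d := d) M φ)
    (he : e ∈ IsManifold.maximalAtlas (cornerModel d) ∞ X) :
    ContDiffOn ℝ ∞ (fun y => φ ((e.extend (cornerModel d)).symm y))
      (e.extend (cornerModel d)).target := by
  rw [← contMDiffOn_iff_contDiffOn]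
  exact hφ.contMDiff.comp_contMDiffOn (contMDiffOn_extend_symm_target he)

theorem IsDefiningFunction.pderiv_chart {φ : X → ℝ} (hφ : IsDefiningFunction (d := d) M φ)
    (he : e ∈ IsManifold.maximalAtlas (cornerModel d) ∞ X)
    (hy : y ∈ (e.extend (cornerModel d)).target) (k : Fin (d + 2)) :
    pderiv k (fun y => φ ((e.extend (cornerModel d)).symm y)) y
      = mfderiv (cornerModel d) 𝓘(ℝ, ℝ) φ ((e.extend (cornerModel d)).symm y)
        (chartFrame e y (EuclideanSpace.single k 1)) := by
  have h := mfderiv_comp_mfderivWithin y (hφ.contMDiff.mdifferentiableAt (by simp))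
    (mdifferentiableWithinAt_chart_symm he hy) (uniqueMDiffWithinAt_range hy)
  rw [mfderivWithin_eq_fderivWithin, range_cornerModel] at h
  unfold pderiv
  have h2 := congrArg (fun L => L (EuclideanSpace.single k 1)) h
  simp only [chartFrame]
  rw [range_cornerModel]
  exact h2

theorem IsDefiningFunction.pderiv_chart_of_ne {φ : X → ℝ} (hφ : IsDefiningFunction (d := d) M φ)
    (he : IsAdaptedChart M Q e) (hy : y ∈ (e.extend (cornerModel d)).target) (hy0 : y 0 = 0)
    {k : Fin (d + 2)} (hk : k ≠ 0) :
    pderiv k (fun y => φ ((e.extend (cornerModel d)).symm y)) y = 0 :=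
  pderiv_eq_zero_of_eqOn_face (isOpenInQuadrant_target e) hy
    ((hφ.contDiffOn_chart he.mem_maximalAtlas).differentiableWithinAt_quadrant
      (isOpenInQuadrant_target e) hy) hk hy0
    fun _ hx hx0 => (hφ.eq_zero_iff _).2 ((he.symm_mem_M_iff hx).2 hx0)

theorem IsDefiningFunction.pderiv_chart_ne_zero {φ : X → ℝ}
    (hφ : IsDefiningFunction (d := d) M φ) (he : IsAdaptedChart M Q e)
    (hy : y ∈ (e.extend (cornerModel d)).target) (hy0 : y 0 = 0) :
    pderiv 0 (fun y => φ ((e.extend (cornerModel d)).symm y)) y ≠ 0 := by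
  intro h0
  refine hφ.mfderiv_ne_zero _ ((he.symm_mem_M_iff hy).2 hy0) ?_
  have hL : (fderivWithin ℝ (fun y => φ ((e.extend (cornerModel d)).symm y)) (quadrant _) y) = 0 := by
    have : (fderivWithin ℝ (fun y => φ ((e.extend (cornerModel d)).symm y))
        (quadrant _) y).toLinearMap = 0 := by
      refine (EuclideanSpace.basisFun (Fin (d + 2)) ℝ).toBasis.ext fun k => ?_
      simp only [OrthonormalBasis.coe_toBasis, EuclideanSpace.basisFun_apply]
      by_cases hk : k = 0
      · subst hk; exact h0
      · exact hφ.pderiv_chart_of_ne he hy hy0 hk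
    exact ContinuousLinearMap.coe_injective this
  have h := mfderiv_comp_mfderivWithin y (hφ.contMDiff.mdifferentiableAt (by simp))
    (mdifferentiableWithinAt_chart_symm he.mem_maximalAtlas hy) (uniqueMDiffWithinAt_range hy)
  rw [mfderivWithin_eq_fderivWithin, range_cornerModel] at h
  ext v
  obtain ⟨w, rfl⟩ := chartFrame_surjective he.mem_maximalAtlas hy v
  have h2 := congrArg (fun L => L w) (h.symm.trans hL)
  simp only [chartFrame]
  rw [range_cornerModel]
  exact h2

variable [IsManifold (cornerModel d) ∞ X]

theorem contDiffOn_chartComponents_inner {k : ℕ∞ω} (gbar : CkMetric d X k) (hk : k + 1 ≤ ∞)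
    (he : e ∈ IsManifold.maximalAtlas (cornerModel d) ∞ X) (i j : Fin (d + 2)) :
    ContDiffOn ℝ k (fun y => chartComponents e gbar.inner y i j)
      (e.extend (cornerModel d)).target := by
  have h := contDiffOn_chartComponents he hk (s := Set.univ) gbar.contMDiff.contMDiffOn i j
  simpa using h

theorem posDef_chartComponents_inner {k : ℕ∞ω} (gbar : CkMetric d X k)
    (he : e ∈ IsManifold.maximalAtlas (cornerModel d) ∞ X)
    (hy : y ∈ (e.extend (cornerModel d)).target) : (chartComponents e gbar.inner y).PosDef :=
  posDef_chartComponents he hy (gbar.symm _) (gbar.pos _)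

theorem IsMetricOff.posDef_chartComponents {g : BilinField d X} (hg : IsMetricOff M g)
    (he : e ∈ IsManifold.maximalAtlas (cornerModel d) ∞ X)
    (hy : y ∈ (e.extend (cornerModel d)).target) (hyM : (e.extend (cornerModel d)).symm y ∉ M) :
    (chartComponents e g y).PosDef :=
  _root_.posDef_chartComponents he hy (hg.symm _ hyM) (hg.pos _ hyM)

theorem IsCompactification.chartComponents_eq {k : ℕ∞ω} {g : BilinField d X} {φ : X → ℝ}
    {gbar : CkMetric d X k} (h : IsCompactification M g φ gbar)
    (hyM : (e.extend (cornerModel d)).symm y ∉ M) :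
    chartComponents e gbar.inner y
      = φ ((e.extend (cornerModel d)).symm y) ^ 2 • chartComponents e g y := by
  ext i j
  simp only [chartComponents, chartForm, h _ hyM]
  rfl

/-- The condition `|dφ| = 1` at a point of `M` in an adapted chart: only `∂₀ φ` is nonzero there. -/
theorem HasUnitDifferential.chart {k : ℕ∞ω} {φ : X → ℝ} {gbar : CkMetric d X k}
    (hφ : IsDefiningFunction (d := d) M φ) (he : IsAdaptedChart M Q e)
    (hy : y ∈ (e.extend (cornerModel d)).target) (hy0 : y 0 = 0)
    (h : HasUnitDifferential gbar φ ((e.extend (cornerModel d)).symm y)) :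
    pderiv 0 (fun y => φ ((e.extend (cornerModel d)).symm y)) y ^ 2
      * (chartComponents e gbar.inner y)⁻¹ 0 0 = 1 := by
  obtain ⟨u, hu, hu1⟩ := h
  obtain ⟨w, rfl⟩ := chartFrame_surjective he.mem_maximalAtlas hy u
  set A := chartComponents e gbar.inner y with hA
  set c := pderiv 0 (fun y => φ ((e.extend (cornerModel d)).symm y)) y with hc
  have hpos := posDef_chartComponents_inner gbar he.mem_maximalAtlas hy
  have hdet : A.det ≠ 0 := hpos.det_pos.ne'
  have h1 : Matrix.mulVec A w.ofLp = Pi.single 0 c := by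
    ext k
    have h2 : chartForm e gbar.inner y (EuclideanSpace.single k 1) w
        = pderiv k (fun y => φ ((e.extend (cornerModel d)).symm y)) y := by
      rw [hφ.pderiv_chart he.mem_maximalAtlas hy, ← hu]
      exact gbar.symm _ _ _
    rw [chartForm_eq_dotProduct] at h2
    simp only [PiLp.ofLp_single, single_dotProduct, one_mul] at h2
    rw [h2]
    by_cases hk : k = 0
    · subst hk; simp [hc]
    · rw [hφ.pderiv_chart_of_ne he hy hy0 hk]; simp [hk]
  have h2 : w.ofLp = Matrix.mulVec A⁻¹ (Pi.single 0 c) := by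
    rw [← h1, Matrix.mulVec_mulVec, Matrix.nonsing_inv_mul _ (Ne.isUnit hdet), Matrix.one_mulVec]
  have h3 : chartForm e gbar.inner y w w = 1 := hu1
  rw [chartForm_eq_dotProduct, ← hA, h1, h2] at h3
  simp at h3
  rw [← h3]; ring

end

/-! ### The scaling limit at a corner point -/

/-- The curve `t ↦ p + t e₀`, which for `p` in the corner runs in `Q` and leaves `M`. -/
noncomputable def transversal {d : ℕ} (p : EuclideanSpace ℝ (Fin (d + 2))) (t : ℝ) :
    EuclideanSpace ℝ (Fin (d + 2)) :=
  p + t • EuclideanSpace.single 0 1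

/-- To first order, `G` looks near `p` like the hyperbolic metric `y₀⁻² A`: along `p + t e₀` the
rescaled components `t² G` tend to `A`, and the rescaled derivatives `t³ ∂ₖ G` tend to those of
`y₀⁻² A`. These are the data that enter the limit of the second fundamental form of `Q`. -/
structure HasScalingLimit {d : ℕ}
    (G : EuclideanSpace ℝ (Fin (d + 2)) → Matrix (Fin (d + 2)) (Fin (d + 2)) ℝ)
    (p : EuclideanSpace ℝ (Fin (d + 2))) (A : Matrix (Fin (d + 2)) (Fin (d + 2)) ℝ) : Prop where
  tendsto : ∀ i j, Tendsto (fun t => t ^ 2 * G (transversal p t) i j) (𝓝[>] 0) (𝓝 (A i j))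
  tendsto_pderiv : ∀ k i j, Tendsto (fun t => t ^ 3 * pderiv k (fun x => G x i j) (transversal p t))
    (𝓝[>] 0) (𝓝 (if k = 0 then -2 * A i j else 0))

section

variable {d : ℕ} {U : Set (EuclideanSpace ℝ (Fin (d + 2)))}
  {G : EuclideanSpace ℝ (Fin (d + 2)) → Matrix (Fin (d + 2)) (Fin (d + 2)) ℝ}
  {φ : EuclideanSpace ℝ (Fin (d + 2)) → ℝ} {p : EuclideanSpace ℝ (Fin (d + 2))}

theorem transversal_zero_apply (hp0 : p 0 = 0) (t : ℝ) : transversal p t 0 = t := by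
  simp [transversal, hp0]

theorem transversal_apply_of_ne {i : Fin (d + 2)} (hi : i ≠ 0) (t : ℝ) :
    transversal p t i = p i := by
  simp [transversal, hi]

theorem tendsto_transversal (hp : p ∈ quadrant (d + 2)) :
    Tendsto (transversal p) (𝓝[>] 0) (𝓝[quadrant (d + 2)] p) :=
  (tendsto_add_smul_single hp 0).mono_left (nhdsWithin_mono _ Set.Ioi_subset_Ici_self)

theorem eventually_transversal_mem (hU : IsOpenInQuadrant U) (hp : p ∈ U) :
    ∀ᶠ t in 𝓝[>] (0 : ℝ), transversal p t ∈ U :=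
  (tendsto_transversal (hU.subset hp)).eventually (hU.mem_nhdsWithin p hp)

theorem ContDiffOn.tendsto_transversal {n : ℕ∞ω} (hU : IsOpenInQuadrant U) (hp : p ∈ U)
    {f : EuclideanSpace ℝ (Fin (d + 2)) → ℝ} (hf : ContDiffOn ℝ n f U) :
    Tendsto (fun t => f (transversal p t)) (𝓝[>] 0) (𝓝 (f p)) :=
  (hf.contDiffWithinAt_quadrant hU hp).continuousWithinAt.tendsto.comp
    (_root_.tendsto_transversal (hU.subset hp))

theorem tendsto_div_transversal (hp : p ∈ quadrant (d + 2))
    (hφ : DifferentiableWithinAt ℝ φ (quadrant (d + 2)) p) (hφp : φ p = 0) :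
    Tendsto (fun t => φ (transversal p t) / t) (𝓝[>] 0) (𝓝 (pderiv 0 φ p)) := by
  have h := (hasDerivWithinAt_comp_add_smul_single hp hφ 0).mono Set.Ioi_subset_Ici_self
  rw [hasDerivWithinAt_iff_tendsto_slope' (by simp)] at h
  refine h.congr fun t => ?_
  simp [slope_def_field, hφp, transversal]

/-- The scaling limit of a conformally compact metric `φ⁻² Gbar`. -/
theorem hasScalingLimit_of_compactification (hU : IsOpenInQuadrant U) (hp : p ∈ U)
    (hp0 : p 0 = 0) {Gbar : EuclideanSpace ℝ (Fin (d + 2)) → Matrix (Fin (d + 2)) (Fin (d + 2)) ℝ}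
    (hGbar : ∀ i j, ContDiffOn ℝ ∞ (fun x => Gbar x i j) U) (hφ : ContDiffOn ℝ ∞ φ U)
    (hφ0 : ∀ x ∈ U, φ x = 0 ↔ x 0 = 0) (hc : pderiv 0 φ p ≠ 0)
    (hG : ∀ x ∈ U, x 0 ≠ 0 → Gbar x = φ x ^ 2 • G x) :
    HasScalingLimit G p ((pderiv 0 φ p ^ 2)⁻¹ • Gbar p) := by
  set c := pderiv 0 φ p
  have hV := hU.inter_ne_zero hφ.continuousOn
  set V := U ∩ {x | φ x ≠ 0}
  have hVm : ∀ᶠ t in 𝓝[>] (0 : ℝ), transversal p t ∈ V ∧ 0 < t := by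
    filter_upwards [eventually_transversal_mem hU hp, self_mem_nhdsWithin] with t ht ht0
    refine ⟨⟨ht, fun h => ?_⟩, ht0⟩
    rw [hφ0 _ ht, transversal_zero_apply hp0] at h
    exact (ne_of_gt ht0) h
  have hφt : Tendsto (fun t => t / φ (transversal p t)) (𝓝[>] 0) (𝓝 c⁻¹) := by
    refine ((tendsto_div_transversal (hU.subset hp) (hφ.differentiableWithinAt_quadrant hU hp)
      ((hφ0 p hp).2 hp0)).inv₀ hc).congr fun t => ?_
    rw [inv_div]
  have hpd : ∀ k, pderiv k φ p = if k = 0 then c else 0 := fun k => by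
    split_ifs with h
    · rw [h]
    · exact pderiv_eq_zero_of_eqOn_face hU hp (hφ.differentiableWithinAt_quadrant hU hp) h hp0
        fun x hx => (hφ0 x hx).2
  have hGV : ∀ x ∈ V, ∀ i j, G x i j = ((φ x)⁻¹ * (φ x)⁻¹) * Gbar x i j := fun x hx i j => by
    rw [hG x hx.1 fun h => hx.2 ((hφ0 x hx.1).2 h)]
    have := hx.2
    simp only [Set.mem_ofPred_eq] at this
    simp only [Matrix.smul_apply, smul_eq_mul]
    field_simp
  have hinv : ContDiffOn ℝ ∞ (fun x => (φ x)⁻¹) V :=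
    (hφ.mono Set.inter_subset_left).inv fun x hx => hx.2
  constructor
  · intro i j
    have h := ((hφt.pow 2).mul ((hGbar i j).tendsto_transversal hU hp))
    rw [Matrix.smul_apply, smul_eq_mul, ← inv_pow]
    refine h.congr' ?_
    filter_upwards [hVm] with t ht
    rw [hGV _ ht.1]
    ring
  · intro k i j
    have h1 := (((hφt.pow 3).mul (((hφ.pderiv hU k).tendsto_transversal hU hp))).mul
      ((hGbar i j).tendsto_transversal hU hp)).const_mul (-2)
    have ht0 : Tendsto (fun t : ℝ => t) (𝓝[>] 0) (𝓝 0) := nhdsWithin_le_nhds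
    have h2 := (ht0.mul (hφt.pow 2)).mul (((hGbar i j).pderiv hU k).tendsto_transversal hU hp)
    have h3 := h1.add h2
    have e1 : (if k = 0 then -2 * ((c ^ 2)⁻¹ • Gbar p) i j else 0)
        = -2 * (c⁻¹ ^ 3 * pderiv k φ p * Gbar p i j)
          + 0 * c⁻¹ ^ 2 * pderiv k (fun x => Gbar x i j) p := by
      rw [hpd k]
      split_ifs
      · simp only [Matrix.smul_apply, smul_eq_mul]; field_simp; ring
      · ring
    rw [e1]
    refine h3.congr' ?_
    filter_upwards [hVm] with t ht
    have hyq := hV.subset ht.1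
    have hφd := hφ.differentiableWithinAt_quadrant hU ht.1.1
    have hid := hinv.differentiableWithinAt_quadrant hV ht.1
    rw [pderiv_congr_on hV ht.1 (fun x hx => hGV x hx i j), pderiv_mul hyq (hid.fun_mul hid)
      ((hGbar i j).differentiableWithinAt_quadrant hU ht.1.1), pderiv_mul hyq hid hid,
      pderiv_inv hyq hφd ht.1.2]
    have := ht.1.2
    simp only [Set.mem_ofPred_eq] at this
    field_simp
    ring

theorem HasScalingLimit.tendsto_inv {A : Matrix (Fin (d + 2)) (Fin (d + 2)) ℝ}
    (h : HasScalingLimit G p A) (hA : A.det ≠ 0)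
    (hdet : ∀ᶠ t in 𝓝[>] (0 : ℝ), (G (transversal p t)).det ≠ 0) (i j : Fin (d + 2)) :
    Tendsto (fun t => (t ^ 2)⁻¹ * (G (transversal p t))⁻¹ i j) (𝓝[>] 0) (𝓝 (A⁻¹ i j)) := by
  have h1 : Tendsto (fun t : ℝ => t ^ 2 • G (transversal p t)) (𝓝[>] 0) (𝓝 A) :=
    tendsto_pi_nhds.2 fun i => tendsto_pi_nhds.2 fun j => h.tendsto i j
  have h2 : ContinuousAt (fun B : Matrix (Fin (d + 2)) (Fin (d + 2)) ℝ => B⁻¹ i j) A := by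
    simp only [Matrix.inv_def, Matrix.smul_apply, smul_eq_mul, Ring.inverse_eq_inv']
    refine ContinuousAt.mul (ContinuousAt.inv₀ (by fun_prop) hA) ?_
    have : Continuous fun B : Matrix (Fin (d + 2)) (Fin (d + 2)) ℝ => B.adjugate :=
      Continuous.matrix_adjugate continuous_id
    exact (this.matrix_elem i j).continuousAt
  refine (h2.tendsto.comp h1).congr' ?_
  filter_upwards [hdet, self_mem_nhdsWithin] with t ht ht0
  exact Matrix.inv_smul_apply ht (pow_ne_zero 2 (ne_of_gt ht0)) i j

/-- If the second fundamental form of `Q` is `lam` times the metric, then in the scaling limit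
`lam` is the product of the unit conormals of `M` and `Q` (when `A⁰⁰ = 1`). -/
theorem HasScalingLimit.lam_mul_sqrt {A : Matrix (Fin (d + 2)) (Fin (d + 2)) ℝ}
    (h : HasScalingLimit G p A) (hA : A.PosDef) {lam : ℝ}
    (hG : ∀ᶠ t in 𝓝[>] (0 : ℝ), (G (transversal p t)).PosDef)
    (hK : ∀ᶠ t in 𝓝[>] (0 : ℝ), secondFundForm G (Fin.last (d + 1)) 0 0 (transversal p t)
      = lam * G (transversal p t) 0 0) :
    lam * √(A⁻¹ (Fin.last (d + 1)) (Fin.last (d + 1))) = A⁻¹ (Fin.last (d + 1)) 0 := by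
  set l := Fin.last (d + 1) with hl
  have hl0 : l ≠ 0 := by simp [hl, Fin.ext_iff]
  have hinv := h.tendsto_inv hA.det_pos.ne' (hG.mono fun t ht => ht.det_pos.ne')
  have hΓ : Tendsto (fun t => t * christoffel G l 0 0 (transversal p t)) (𝓝[>] 0)
      (𝓝 (A⁻¹ l 0 * A 0 0)) := by
    have h1 : Tendsto (fun t => (1 / 2) * ∑ k, ((t ^ 2)⁻¹ * (G (transversal p t))⁻¹ l k) *
        (t ^ 3 * pderiv 0 (fun x => G x 0 k) (transversal p t)
          + t ^ 3 * pderiv 0 (fun x => G x 0 k) (transversal p t)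
          - t ^ 3 * pderiv k (fun x => G x 0 0) (transversal p t))) (𝓝[>] 0)
        (𝓝 ((1 / 2) * ∑ k, A⁻¹ l k * ((if (0 : Fin (d + 2)) = 0 then -2 * A 0 k else 0)
          + (if (0 : Fin (d + 2)) = 0 then -2 * A 0 k else 0)
          - (if k = 0 then -2 * A 0 0 else 0)))) :=
      (tendsto_finsetSum _ fun k _ => (hinv l k).mul (((h.tendsto_pderiv 0 0 k).add
        (h.tendsto_pderiv 0 0 k)).sub (h.tendsto_pderiv k 0 0))).const_mul _
    have e1 : (1 / 2) * ∑ k, A⁻¹ l k * ((if (0 : Fin (d + 2)) = 0 then -2 * A 0 k else 0)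
          + (if (0 : Fin (d + 2)) = 0 then -2 * A 0 k else 0)
          - (if k = 0 then -2 * A 0 0 else 0)) = A⁻¹ l 0 * A 0 0 := by
      -- only the derivative of the conformal factor in the direction `e₀` survives
      have e2 : ∑ k, A⁻¹ l k * A 0 k = 0 := by
        have h0 := Matrix.sum_nonsing_inv_mul hA.det_pos.ne' l 0
        rw [if_neg hl0] at h0
        rw [← h0]
        exact Finset.sum_congr rfl fun k _ => by rw [← hA.isHermitian.apply 0 k]; rfl
      have e3 : ∑ k, A⁻¹ l k * (if k = 0 then -2 * A 0 0 else 0) = -2 * (A⁻¹ l 0 * A 0 0) := by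
        simp only [mul_ite, mul_zero, Finset.sum_ite_eq', Finset.mem_univ, if_true]; ring
      simp only [if_true, mul_sub, Finset.sum_sub_distrib, e3]
      rw [show ∑ k, A⁻¹ l k * (-2 * A 0 k + -2 * A 0 k) = -4 * ∑ k, A⁻¹ l k * A 0 k by
        rw [Finset.mul_sum]; exact Finset.sum_congr rfl fun k _ => by ring, e2]
      ring
    rw [e1] at h1
    refine h1.congr' ?_
    filter_upwards [self_mem_nhdsWithin] with t ht
    have ht' : t ≠ 0 := ne_of_gt ht
    rw [christoffel, Finset.mul_sum, Finset.mul_sum, Finset.mul_sum]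
    refine Finset.sum_congr rfl fun k _ => ?_
    field_simp
  have hll : 0 < A⁻¹ l l := hA.inv.diag_pos
  have hK1 : Tendsto (fun t => lam * (t ^ 2 * G (transversal p t) 0 0)
      * √((t ^ 2)⁻¹ * (G (transversal p t))⁻¹ l l)) (𝓝[>] 0)
      (𝓝 (lam * A 0 0 * √(A⁻¹ l l))) :=
    ((h.tendsto 0 0).const_mul lam).mul (hinv l l).sqrt
  have hK2 := hK1.congr' (f₂ := fun t => t * christoffel G l 0 0 (transversal p t)) (by
    filter_upwards [hK, hG, self_mem_nhdsWithin] with t ht hGt ht0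
    have ht0' : (0 : ℝ) < t := ht0
    rw [secondFundForm_eq (by simpa using hGt.isHermitian) hGt.det_pos.ne'] at ht
    have hpos : 0 < √((G (transversal p t))⁻¹ l l) := Real.sqrt_pos.2 hGt.inv.diag_pos
    rw [div_eq_iff hpos.ne'] at ht
    rw [ht, Real.sqrt_mul (by positivity), Real.sqrt_inv, Real.sqrt_sq ht0'.le]
    field_simp)
  have := tendsto_nhds_unique hK2 hΓ
  have hA0 : 0 < A 0 0 := hA.diag_pos
  have h5 : A 0 0 * (lam * √(A⁻¹ l l)) = A 0 0 * A⁻¹ l 0 := by linarith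
  exact mul_left_cancel₀ hA0.ne' h5

end

/-! ### Zero-edge tensors that vanish on the front face -/

section

variable {d : ℕ} {z : EuclideanSpace ℝ (Fin (d + 2))}

theorem contDiff_polarMap : ContDiff ℝ ∞ (polarMap (d := d)) := by
  refine contDiff_euclidean.2 fun i => ?_
  have h : ∀ j : Fin (d + 2), ContDiff ℝ ∞ fun z : EuclideanSpace ℝ (Fin (d + 2)) => z j :=
    fun j => contDiff_euclidean.1 contDiff_id j
  simp only [polarMap]
  split_ifs
  · exact (h _).mul (Real.contDiff_sin.comp (h _))
  · exact (h _).mul (Real.contDiff_cos.comp (h _))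
  · exact h _

theorem fderiv_polarMap_apply (v : EuclideanSpace ℝ (Fin (d + 2))) (i : Fin (d + 2)) :
    fderiv ℝ polarMap z v i = if i = 0 then v (Fin.last (d + 1)) * Real.sin (z 0)
        + z (Fin.last (d + 1)) * (Real.cos (z 0) * v 0)
      else if i = Fin.last (d + 1) then v (Fin.last (d + 1)) * Real.cos (z 0)
        - z (Fin.last (d + 1)) * (Real.sin (z 0) * v 0)
      else v i := by
  have h1 : HasFDerivAt (fun z : EuclideanSpace ℝ (Fin (d + 2)) => polarMap z i)
      ((EuclideanSpace.proj (𝕜 := ℝ) i).comp (fderiv ℝ polarMap z)) z :=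
    (EuclideanSpace.proj (𝕜 := ℝ) i).hasFDerivAt.comp z
      (contDiff_polarMap.differentiable (by simp) z).hasFDerivAt
  have h : ∀ j : Fin (d + 2), HasFDerivAt (fun z : EuclideanSpace ℝ (Fin (d + 2)) => z j)
      (EuclideanSpace.proj (𝕜 := ℝ) j) z := fun j => (EuclideanSpace.proj (𝕜 := ℝ) j).hasFDerivAt
  have h2 := fun L hL => DFunLike.congr_fun (h1.unique (f₁' := L) hL) v
  simp only [polarMap] at h2
  split_ifs at h2 ⊢
  · refine (h2 _ ((h _).mul ((h 0).sin))).trans ?_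
    simp; ring
  · refine (h2 _ ((h _).mul ((h 0).cos))).trans ?_
    simp; ring
  · exact h2 _ (h _)

/-- The coefficients of the coordinate frame in terms of the zero-edge frame, up to the factor
`ρ sin θ`: a rotation in the plane of the first and the last coordinate. -/
noncomputable def polarRotation (z : EuclideanSpace ℝ (Fin (d + 2))) (i a : Fin (d + 2)) : ℝ :=
  if i = 0 then (if a = 0 then Real.cos (z 0) else if a = Fin.last (d + 1) then Real.sin (z 0)
    else 0)
  else if i = Fin.last (d + 1) then (if a = 0 then -Real.sin (z 0)
    else if a = Fin.last (d + 1) then Real.cos (z 0) else 0)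
  else if a = i then 1 else 0

theorem contDiff_polarRotation (i a : Fin (d + 2)) :
    ContDiff ℝ ∞ fun z : EuclideanSpace ℝ (Fin (d + 2)) => polarRotation z i a := by
  have h : ContDiff ℝ ∞ fun z : EuclideanSpace ℝ (Fin (d + 2)) => z 0 :=
    contDiff_euclidean.1 contDiff_id 0
  have hs := Real.contDiff_sin.comp h
  have hc := Real.contDiff_cos.comp h
  unfold polarRotation
  split_ifs
  exacts [hc, hs, contDiff_const, hs.neg, hc, contDiff_const, contDiff_const, contDiff_const]

theorem sum_polarRotation_smul (i : Fin (d + 2)) :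
    ∑ a, polarRotation z i a • zeroEdgeFrame z a
      = (z (Fin.last (d + 1)) * Real.sin (z 0)) • EuclideanSpace.single i 1 := by
  set l := Fin.last (d + 1) with hl
  have hl0 : l ≠ 0 := by simp [hl, Fin.ext_iff]
  have hsc := Real.sin_sq_add_cos_sq (z 0)
  have two : ∀ (α β : ℝ), ∑ a, (if a = 0 then α else if a = l then β else 0) • zeroEdgeFrame z a
      = α • zeroEdgeFrame z 0 + β • zeroEdgeFrame z l := by
    intro α β
    have : ∀ a, (if a = 0 then α else if a = l then β else 0) • zeroEdgeFrame z a
        = (if a = 0 then α • zeroEdgeFrame z a else 0)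
          + (if a = l then β • zeroEdgeFrame z a else 0) := by
      intro a
      by_cases h0 : a = 0
      · subst h0; simp [hl0.symm]
      · by_cases h1 : a = l <;> simp [h0, h1, hl0]
    simp only [this, Finset.sum_add_distrib, Finset.sum_ite_eq', Finset.mem_univ, if_true]
  have hf : ∀ a j, zeroEdgeFrame z a j = (if a = 0 then Real.sin (z 0)
      else z l * Real.sin (z 0)) * fderiv ℝ polarMap z (EuclideanSpace.single a 1) j := by
    intro a j; rfl
  unfold polarRotation
  by_cases h0 : i = 0
  · subst h0
    simp only [if_true, ← hl, two]
    ext j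
    simp only [PiLp.add_apply, PiLp.smul_apply, smul_eq_mul, hf, fderiv_polarMap_apply, ← hl,
      PiLp.single_apply, if_neg hl0, if_neg hl0.symm, if_true]
    split_ifs with h1 h2
    · linear_combination z l * Real.sin (z 0) * hsc
    · ring
    · ring
  · by_cases h1 : i = l
    · subst h1
      simp only [← hl, if_neg hl0, if_true, two]
      ext j
      simp only [PiLp.add_apply, PiLp.smul_apply, smul_eq_mul, hf, fderiv_polarMap_apply, ← hl,
        PiLp.single_apply, if_neg hl0, if_neg hl0.symm, if_true]
      split_ifs with h1 h2
      · exact absurd (h2.symm.trans h1) hl0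
      · ring
      · linear_combination z l * Real.sin (z 0) * hsc
      · ring
    · simp only [← hl, if_neg h0, if_neg h1, ite_smul, zero_smul, one_smul, Finset.sum_ite_eq',
        Finset.mem_univ, if_true]
      ext j
      simp only [PiLp.smul_apply, smul_eq_mul, hf, fderiv_polarMap_apply, ← hl,
        PiLp.single_apply, if_neg h0,
        if_neg (Ne.symm h0), if_neg (Ne.symm h1)]
      by_cases h2 : j = i
      · simp [h2, h0, h1]
      · simp [h2]

end

section

variable {d : ℕ} {X : Type*} [TopologicalSpace X] [ChartedSpace (EuclideanQuadrant (d + 2)) X]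
  {e : OpenPartialHomeomorph X (EuclideanQuadrant (d + 2))} {M Q : Set X}
  {p : EuclideanSpace ℝ (Fin (d + 2))}

theorem chartForm_sum_smul {ι : Type*} (s : Finset ι) (T : BilinField d X)
    (y : EuclideanSpace ℝ (Fin (d + 2))) (c c' : ι → ℝ)
    (v w : ι → EuclideanSpace ℝ (Fin (d + 2))) :
    chartForm e T y (∑ a ∈ s, c a • v a) (∑ b ∈ s, c' b • w b)
      = ∑ a ∈ s, ∑ b ∈ s, c a * c' b * chartForm e T y (v a) (w b) := by
  change T _ (chartFrame e y _) (chartFrame e y _) = _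
  simp only [map_sum, map_smul, sum_apply, smul_apply, smul_eq_mul, Finset.mul_sum]
  rw [Finset.sum_comm]
  exact Finset.sum_congr rfl fun a _ => Finset.sum_congr rfl fun b _ => by
    rw [← mul_assoc, mul_comm (c' b)]; rfl

theorem chartForm_smul_smul (T : BilinField d X) (y : EuclideanSpace ℝ (Fin (d + 2))) (c c' : ℝ)
    (v w : EuclideanSpace ℝ (Fin (d + 2))) :
    chartForm e T y (c • v) (c' • w) = c * c' * chartForm e T y v w := by
  simpa using chartForm_sum_smul (e := e) {()} T y (fun _ => c) (fun _ => c') (fun _ => v)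
    (fun _ => w)

/-- The components in the zero-edge coframe determine the components in the chart of `X`. -/
theorem IsZeroEdgeLift.sq_mul_chartComponents {T : BilinField d X}
    {B : EuclideanSpace ℝ (Fin (d + 2)) → Matrix (Fin (d + 2)) (Fin (d + 2)) ℝ}
    (hB : IsZeroEdgeLift e T B) {z : EuclideanSpace ℝ (Fin (d + 2))} (hz : z ∈ polarDomain e)
    (h0 : 0 < z 0) (hρ : 0 < z (Fin.last (d + 1))) (i j : Fin (d + 2)) :
    z (Fin.last (d + 1)) ^ 2 * chartComponents e T (polarMap z) i j
      = (∑ a, ∑ b, polarRotation z i a * polarRotation z j b * B z a b) / Real.sin (z 0) ^ 2 := by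
  have hs : 0 < Real.sin (z 0) :=
    Real.sin_pos_of_pos_of_lt_pi h0 (hz.2.1.trans_lt (by linarith [Real.pi_pos]))
  simp only [hB.eq_components z hz h0 hρ]
  rw [← chartForm_sum_smul, sum_polarRotation_smul, sum_polarRotation_smul, chartForm_smul_smul,
    chartComponents]
  field_simp

/-- A zero-edge tensor that vanishes on the front face does not contribute to the scaling limit at
a corner point. Its components are `ρ⁻²` times functions that are smooth up to the front face and
vanish there; the direction `∂_θ` is tangent to that face, so the `θ`-derivative, which is `-ρ` times
the derivative in the last coordinate, is of lower order as well. -/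
theorem IsZeroEdgeLift.hasScalingLimit_zero (he : IsAdaptedChart M Q e)
    (hp : p ∈ (e.extend (cornerModel d)).target) (hp0 : p 0 = 0)
    (hpl : p (Fin.last (d + 1)) = 0) {T : BilinField d X}
    {B : EuclideanSpace ℝ (Fin (d + 2)) → Matrix (Fin (d + 2)) (Fin (d + 2)) ℝ}
    (hB : IsZeroEdgeLift e T B)
    (hB0 : ∀ z ∈ polarDomain e, z (Fin.last (d + 1)) = 0 → B z = 0)
    (hT : ∀ y ∈ (e.extend (cornerModel d)).target, y 0 ≠ 0 → ∀ i j,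
      DifferentiableWithinAt ℝ (fun x => chartComponents e T x i j) (quadrant (d + 2)) y) :
    HasScalingLimit (chartComponents e T) p 0 := by
  set l := Fin.last (d + 1) with hl
  have hl0 : l ≠ 0 := by simp [hl, Fin.ext_iff]
  set D := polarDomain e
  set U := (e.extend (cornerModel d)).target
  have hU := isOpenInQuadrant_target (d := d) e
  have hpi := Real.pi_pos
  -- the lift of the curve `transversal p`: it runs in the lift `θ = π / 2` of `Q`
  set zt : ℝ → EuclideanSpace ℝ (Fin (d + 2)) := fun t =>
    WithLp.toLp 2 fun i => if i = 0 then Real.pi / 2 else if i = l then t else p i with hzt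
  have zt0 : ∀ t, zt t 0 = Real.pi / 2 := fun t => by simp [hzt]
  have ztl : ∀ t, zt t l = t := fun t => by simp [hzt, hl0]
  have ztk : ∀ t k, k ≠ 0 → k ≠ l → zt t k = p k := fun t k h h' => by simp [hzt, h, h']
  have hpolar : ∀ t, polarMap (zt t) = transversal p t := by
    intro t
    ext i
    simp only [polarMap, ← hl, zt0, ztl, Real.sin_pi_div_two, Real.cos_pi_div_two]
    split_ifs with h h'
    · subst h; rw [transversal_zero_apply hp0]; ring
    · subst h'; rw [transversal_apply_of_ne h, hpl]; ring
    · rw [transversal_apply_of_ne h, ztk t i h h']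
  have hztc : Continuous zt := by
    refine (PiLp.continuous_toLp 2 _).comp (continuous_pi fun i => ?_)
    split_ifs <;> fun_prop
  have hztD : ∀ᶠ t in 𝓝[>] (0 : ℝ), zt t ∈ D := by
    filter_upwards [eventually_transversal_mem hU hp, self_mem_nhdsWithin] with t ht ht0
    exact ⟨by rw [zt0]; positivity, by rw [zt0], by rw [← hl, ztl]; exact le_of_lt ht0,
      by rw [hpolar]; exact ht⟩
  have hz0D : zt 0 ∈ D := ⟨by rw [zt0]; positivity, by rw [zt0], by rw [← hl, ztl],
    by
      rw [hpolar, transversal, zero_smul, add_zero]; exact hp⟩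
  have hzt_tendsto : Tendsto zt (𝓝[>] 0) (𝓝[D] (zt 0)) :=
    tendsto_nhdsWithin_iff.2 ⟨(hztc.tendsto 0).mono_left nhdsWithin_le_nhds, hztD⟩
  -- curves in the coordinate directions stay in the polar domain, if they go inwards
  have hcurve : ∀ t, 0 ≤ t → zt t ∈ D → ∀ k, ∀ ε : ℝ, (k = 0 → ε = -1) → (k ≠ 0 → ε = 1) →
      ∀ᶠ s in 𝓝[≥] (0 : ℝ), zt t + s • (ε • EuclideanSpace.single k (1 : ℝ)) ∈ D ∧
        0 < (zt t + s • (ε • EuclideanSpace.single k (1 : ℝ))) 0 := by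
    intro t ht htD k ε hε0 hε1
    set σ : ℝ → EuclideanSpace ℝ (Fin (d + 2)) := fun s =>
      zt t + s • (ε • EuclideanSpace.single k (1 : ℝ)) with hσ
    have hσc : Continuous σ := by fun_prop
    have hσ0 : σ 0 = zt t := by simp [hσ]
    have hlim : Tendsto (fun s => polarMap (σ s)) (𝓝 0) (𝓝 (polarMap (zt t))) := by
      rw [← hσ0]
      exact ((contDiff_polarMap (d := d)).continuous.comp hσc).tendsto 0
    have hθ : ∀ᶠ s in 𝓝[≥] (0 : ℝ), 0 < σ s 0 := by
      have : Continuous fun s => σ s 0 := by fun_prop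
      have h2 := (this.tendsto 0).mono_left (nhdsWithin_le_nhds (s := Set.Ici 0))
      rw [hσ0, zt0] at h2
      exact h2.eventually (lt_mem_nhds (by positivity))
    have hbound : ∀ s, 0 ≤ s → σ s 0 ≤ Real.pi / 2 ∧ 0 ≤ σ s l ∧
        ∀ j, j ≠ 0 → j ≠ l → 0 ≤ σ s j := by
      intro s hs
      have hσj : ∀ j, σ s j = zt t j + if j = k then s * ε else 0 := fun j => by simp [hσ]
      refine ⟨?_, ?_, fun j hj hj' => ?_⟩
      · rw [hσj, zt0]
        split_ifs with h
        · rw [hε0 h.symm]; linarith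
        · linarith
      · rw [hσj, ztl]
        split_ifs with h
        · rw [hε1 (h ▸ hl0)]; linarith
        · linarith
      · rw [hσj, ztk t j hj hj']
        have := (he.pos_of_mem_target hp j hj hj').le
        split_ifs with h
        · rw [hε1 (h ▸ hj)]; linarith
        · linarith
    have htarget : ∀ᶠ s in 𝓝[≥] (0 : ℝ), polarMap (σ s) ∈ U := by
      have h1 : Tendsto (fun s => polarMap (σ s)) (𝓝[≥] 0)
          (𝓝[quadrant (d + 2)] (polarMap (zt t))) := by
        refine tendsto_nhdsWithin_iff.2 ⟨hlim.mono_left nhdsWithin_le_nhds, ?_⟩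
        filter_upwards [hθ, self_mem_nhdsWithin] with s hs hs0 j
        obtain ⟨b1, b2, b3⟩ := hbound s hs0
        simp only [polarMap, ← hl]
        split_ifs with h h'
        · exact mul_nonneg b2 (Real.sin_nonneg_of_nonneg_of_le_pi hs.le (by linarith))
        · exact mul_nonneg b2 (Real.cos_nonneg_of_neg_pi_div_two_le_of_le (by linarith) b1)
        · exact b3 j h h'
      exact h1.eventually (hU.mem_nhdsWithin _ htD.2.2.2)
    filter_upwards [hθ, htarget, self_mem_nhdsWithin] with s h1 h2 hs0
    exact ⟨⟨h1.le, (hbound s hs0).1, (hbound s hs0).2.1, h2⟩, h1⟩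
  -- `f'` is the derivative, up to the front face, of the function that agrees with `ρ² T i j` off it;
  -- the last clause is the chain rule for the blow-down map
  have key : ∀ i j, ∃ f' : EuclideanSpace ℝ (Fin (d + 2)) → EuclideanSpace ℝ (Fin (d + 2)) →L[ℝ] ℝ,
      Tendsto (fun t => f' (zt t)) (𝓝[>] 0) (𝓝 (f' (zt 0))) ∧
      f' (zt 0) (EuclideanSpace.single 0 1) = 0 ∧
      Tendsto (fun t => t ^ 2 * chartComponents e T (transversal p t) i j) (𝓝[>] 0) (𝓝 0) ∧
      ∀ᶠ t in 𝓝[>] (0 : ℝ), ∀ k, f' (zt t) (EuclideanSpace.single k 1)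
        = (if k = l then 2 * t * chartComponents e T (transversal p t) i j else 0)
          + t ^ 2 * fderivWithin ℝ (fun x => chartComponents e T x i j) (quadrant (d + 2))
            (transversal p t) (fderiv ℝ polarMap (zt t) (EuclideanSpace.single k 1)) := by
    intro i j
    set C : EuclideanSpace ℝ (Fin (d + 2)) → ℝ := fun z =>
      (∑ a, ∑ b, polarRotation z i a * polarRotation z j b * B z a b) / Real.sin (z 0) ^ 2 with hC
    have hC0 : ∀ z ∈ D, z l = 0 → C z = 0 := fun z hz hzl => by
      simp [hC, hB0 z hz hzl]
    have hCs : ContDiffWithinAt ℝ ∞ C D (zt 0) := by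
      refine ContDiffWithinAt.div ?_ ?_ (by rw [zt0]; simp)
      · refine ContDiffWithinAt.sum fun a _ => ContDiffWithinAt.sum fun b _ => ?_
        exact (((contDiff_polarRotation i a).mul
          (contDiff_polarRotation j b)).contDiffWithinAt).mul (hB.contDiffOn a b _ hz0D)
      · have h : ContDiff ℝ ∞ fun z : EuclideanSpace ℝ (Fin (d + 2)) => z 0 :=
          contDiff_euclidean.1 contDiff_id 0
        exact ((Real.contDiff_sin.comp h).pow 2).contDiffWithinAt
    obtain ⟨u, hu, -, -, f', hf', hf'c⟩ := (contDiffWithinAt_succ_iff_hasFDerivWithinAt'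
      (n := 0) (by simp)).1 (hCs.of_le (m := 0 + 1) (by exact_mod_cast le_top))
    rw [Set.insert_eq_of_mem hz0D] at hu
    have hcomp : ∀ t k, ∀ ε : ℝ, zt t ∈ u → zt t ∈ D → 0 ≤ t → (k = 0 → ε = -1) → (k ≠ 0 → ε = 1) →
        HasDerivWithinAt (fun s : ℝ => C (zt t + s • (ε • EuclideanSpace.single k (1 : ℝ))))
          (f' (zt t) (ε • EuclideanSpace.single k 1)) (Set.Ici 0) 0 := by
      intro t k ε htu htD ht h0 h1
      have hS := (hcurve t ht htD k ε h0 h1).mono fun s hs => hs.1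
      have h2 : HasDerivWithinAt (fun s : ℝ => zt t + s • (ε • EuclideanSpace.single k (1 : ℝ)))
          (ε • EuclideanSpace.single k (1 : ℝ))
          {s | zt t + s • (ε • EuclideanSpace.single k (1 : ℝ)) ∈ D} 0 := by
        have h := ((hasDerivAt_id (0 : ℝ)).smul_const (ε • EuclideanSpace.single k (1 : ℝ))
          |>.const_add (zt t))
        rw [one_smul] at h
        exact h.hasDerivWithinAt
      have h3 := HasFDerivWithinAt.comp_hasDerivWithinAt_of_eq (0 : ℝ) (hf' _ htu) h2
        (fun s hs => hs) (by simp)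
      exact h3.mono_of_mem_nhdsWithin hS
    refine ⟨f', ?_, ?_, ?_, ?_⟩
    · exact hf'c.continuousWithinAt.tendsto.comp hzt_tendsto
    -- `∂_θ` is tangent to the front face, where `C` vanishes
    · have hd := hcomp 0 0 (-1) (mem_of_mem_nhdsWithin hz0D hu) hz0D le_rfl (fun _ => rfl)
        (fun h => absurd rfl h)
      have hd' : HasDerivWithinAt
          (fun s : ℝ => C (zt 0 + s • ((-1 : ℝ) • EuclideanSpace.single 0 (1 : ℝ)))) 0
          (Set.Ici 0) 0 := by
        refine (hasDerivWithinAt_const (0 : ℝ) _ (0 : ℝ)).congr_of_eventuallyEq ?_ ?_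
        · filter_upwards [hcurve 0 le_rfl hz0D 0 (-1) (fun _ => rfl) (fun h => absurd rfl h)]
            with s hs
          exact hC0 _ hs.1 (by simp [ztl, hl0])
        · exact hC0 _ (by simpa using hz0D) (by simp [ztl])
      have := (uniqueDiffOn_Ici 0 0 Set.self_mem_Ici).eq_deriv _ hd hd'
      simpa using this
    · have h := hCs.continuousWithinAt.tendsto.comp hzt_tendsto
      rw [hC0 _ hz0D (ztl 0)] at h
      refine h.congr' ?_
      filter_upwards [hztD, self_mem_nhdsWithin] with t ht ht0
      have := hB.sq_mul_chartComponents ht (by rw [zt0]; positivity)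
        (by rw [← hl, ztl]; exact ht0) i j
      rw [hpolar, ← hl, ztl] at this
      exact this.symm
    · filter_upwards [hztD, self_mem_nhdsWithin, hzt_tendsto.eventually hu] with t ht ht0 htu k
      have ht0' : (0 : ℝ) < t := ht0
      -- both sides are one-sided derivatives of `ρ² T i j` along the same coordinate line
      obtain ⟨ε, h0, h1, hε⟩ : ∃ ε : ℝ, (k = 0 → ε = -1) ∧ (k ≠ 0 → ε = 1) ∧ ε ≠ 0 := by
        by_cases hk : k = 0
        · exact ⟨-1, fun _ => rfl, fun h => absurd hk h, by norm_num⟩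
        · exact ⟨1, fun h => absurd h hk, fun _ => rfl, by norm_num⟩
      have hd := hcomp t k ε htu ht ht0'.le h0 h1
      have hS := hcurve t ht0'.le ht k ε h0 h1
      set σ : ℝ → EuclideanSpace ℝ (Fin (d + 2)) := fun s =>
        zt t + s • (ε • EuclideanSpace.single k (1 : ℝ)) with hσ
      have hσ0 : σ 0 = zt t := by simp [hσ]
      have hσder : HasDerivAt σ (ε • EuclideanSpace.single k (1 : ℝ)) 0 := by
        have h := ((hasDerivAt_id (0 : ℝ)).smul_const (ε • EuclideanSpace.single k (1 : ℝ))
          |>.const_add (zt t))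
        rwa [one_smul] at h
      have hP : HasDerivAt (fun s => polarMap (σ s))
          (fderiv ℝ polarMap (zt t) (ε • EuclideanSpace.single k 1)) 0 :=
        ((contDiff_polarMap (d := d)).differentiable (by simp)
          (zt t)).hasFDerivAt.comp_hasDerivAt_of_eq (0 : ℝ) hσder hσ0.symm
      have hyU : transversal p t ∈ U := by rw [← hpolar]; exact ht.2.2.2
      have hTd := (hT _ hyU (by rw [transversal_zero_apply hp0]; exact ht0'.ne')
        i j).hasFDerivWithinAt
      have hL : HasDerivWithinAt (fun s => chartComponents e T (polarMap (σ s)) i j)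
          (fderivWithin ℝ (fun x => chartComponents e T x i j) (quadrant (d + 2))
            (transversal p t) (fderiv ℝ polarMap (zt t) (ε • EuclideanSpace.single k 1)))
          {s | σ s ∈ D} 0 :=
        HasFDerivWithinAt.comp_hasDerivWithinAt_of_eq (0 : ℝ) hTd hP.hasDerivWithinAt
          (fun s hs => hU.subset hs.2.2.2) (by rw [hσ0, hpolar])
      have hL' := hL.mono_of_mem_nhdsWithin (hS.mono fun s hs => hs.1)
      have hρ : HasDerivWithinAt (fun s => σ s l) (if k = l then ε else 0) (Set.Ici 0) 0 := by
        have := ((EuclideanSpace.proj (𝕜 := ℝ) l).hasFDerivAt.comp_hasDerivAt (0 : ℝ)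
          hσder).hasDerivWithinAt (s := Set.Ici 0)
        have e1 : EuclideanSpace.proj (𝕜 := ℝ) l (ε • EuclideanSpace.single k (1 : ℝ))
            = if k = l then ε else 0 := by simp [eq_comm]
        rw [e1] at this
        exact this
      have hprod := (hρ.pow 2).mul hL'
      have heq : (fun s => C (σ s)) =ᶠ[𝓝[≥] 0]
          fun s => σ s l ^ 2 * chartComponents e T (polarMap (σ s)) i j := by
        have hpos : ∀ᶠ s in 𝓝[≥] (0 : ℝ), 0 < σ s l := by
          have h2 := hρ.continuousWithinAt.tendsto
          rw [hσ0, ztl] at h2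
          exact h2.eventually (lt_mem_nhds ht0')
        filter_upwards [hS, hpos] with s hs hs'
        exact (hB.sq_mul_chartComponents hs.1 hs.2 hs' i j).symm
      have hd2 := HasDerivWithinAt.congr_of_eventuallyEq hprod heq
        (heq.self_of_nhdsWithin Set.self_mem_Ici)
      have hfin := (uniqueDiffOn_Ici 0 0 Set.self_mem_Ici).eq_deriv _ hd hd2
      simp only [map_smul, smul_eq_mul, Pi.pow_apply, hσ0, hpolar, ztl, Nat.cast_ofNat] at hfin
      apply mul_left_cancel₀ hε
      rw [hfin]
      split_ifs <;> simp <;> ring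
  have ht1 : Tendsto (fun t : ℝ => t) (𝓝[>] 0) (𝓝 0) := nhdsWithin_le_nhds
  constructor
  · intro i j
    obtain ⟨f', -, -, h, -⟩ := key i j
    exact h
  · intro k i j
    obtain ⟨f', hf', hf0, hT0, hf⟩ := key i j
    have hf'k : ∀ k, Tendsto (fun t => f' (zt t) (EuclideanSpace.single k 1)) (𝓝[>] 0)
        (𝓝 (f' (zt 0) (EuclideanSpace.single k 1))) := fun k =>
      ((ContinuousLinearMap.apply ℝ ℝ
        (EuclideanSpace.single k (1 : ℝ))).continuous.tendsto _).comp hf'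
    have hv : ∀ t k, fderiv ℝ polarMap (zt t) (EuclideanSpace.single k 1)
        = if k = 0 then -t • EuclideanSpace.single l (1 : ℝ)
          else if k = l then EuclideanSpace.single 0 1 else EuclideanSpace.single k 1 := by
      intro t k
      ext a
      rw [fderiv_polarMap_apply, zt0, ← hl, ztl, Real.sin_pi_div_two, Real.cos_pi_div_two]
      by_cases hk : k = 0
      · subst hk
        by_cases ha : a = 0
        · subst ha; simp [hl0]
        · by_cases hal : a = l
          · subst hal; simp [hl0]
          · simp [ha, hal]
      · by_cases hkl : k = l
        · subst hkl
          by_cases ha : a = 0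
          · subst ha; simp [hl0]
          · by_cases hal : a = l
            · subst hal; simp [hl0, hl0.symm]
            · simp [ha, hal, hl0]
        · by_cases ha : a = 0
          · subst ha; simp [hk, hkl, Ne.symm hk, Ne.symm hkl]
          · by_cases hal : a = l
            · subst hal; simp [hk, hkl, Ne.symm hk, Ne.symm hkl, hl0]
            · simp [ha, hal, hk, hkl]
    have hgoal : (if k = 0 then -2 * (0 : Matrix (Fin (d + 2)) (Fin (d + 2)) ℝ) i j else 0)
        = 0 := by simp
    rw [hgoal]
    simp only [hv] at hf
    by_cases hk : k = 0
    · subst hk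
      have h := ((ht1.mul (hf'k l)).sub (hT0.const_mul 2))
      simp only [zero_mul, mul_zero, sub_zero] at h
      refine h.congr' ?_
      filter_upwards [hf] with t ht
      have := ht l
      simp only [if_neg hl0, if_true] at this
      rw [this, pderiv]
      ring
    · by_cases hkl : k = l
      · have h := (hf'k 0).neg
        rw [hf0, neg_zero] at h
        refine h.congr' ?_
        filter_upwards [hf] with t ht
        have := ht 0
        simp only [if_neg hl0.symm, if_true] at this
        rw [this, pderiv, hkl]
        simp only [map_smul, smul_eq_mul]
        ring
      · have h := ht1.mul (hf'k k)
        simp only [zero_mul] at h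
        refine h.congr' ?_
        filter_upwards [hf] with t ht
        have := ht k
        simp only [if_neg hk, if_neg hkl] at this
        rw [this, pderiv]
        ring

end

/-! ### The angle at the corner -/

theorem Matrix.PosDef.sq_lt_mul {m : ℕ} {P : Matrix (Fin m) (Fin m) ℝ} (hP : P.PosDef)
    {k l : Fin m} (hkl : k ≠ l) : P l k ^ 2 < P k k * P l l := by
  have hinj : Function.Injective ![k, l] := by
    intro i j h
    fin_cases i <;> fin_cases j <;> simp_all
  have h := (hP.submatrix hinj).det_pos
  rw [Matrix.det_fin_two] at h
  have hs : P k l = P l k := hP.isHermitian.apply l k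
  simp only [Matrix.submatrix_apply, Matrix.cons_val_zero, Matrix.cons_val_one, hs] at h
  nlinarith

section

variable {m : ℕ} {A : Matrix (Fin m) (Fin m) ℝ} {k l : Fin m}

/-- A vector whose dual covector only involves the `k`-th and the `l`-th coordinate. -/
theorem eq_of_mulVec_support (hA : A.PosDef) (hkl : k ≠ l) {u : Fin m → ℝ}
    (hu : ∀ i, i ≠ k → i ≠ l → (A.mulVec u) i = 0) (i : Fin m) :
    u i = A⁻¹ i k * (A.mulVec u) k + A⁻¹ i l * (A.mulVec u) l := by
  have h : u = A⁻¹.mulVec (A.mulVec u) := by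
    rw [Matrix.mulVec_mulVec, Matrix.nonsing_inv_mul _ (Ne.isUnit hA.det_pos.ne'),
      Matrix.one_mulVec]
  conv_lhs => rw [h]
  rw [Matrix.mulVec, dotProduct, Fintype.sum_eq_add k l hkl]
  intro x hx
  rw [hu x hx.1 hx.2, mul_zero]

/-- The cosine of the angle between the faces `{u k = 0}` and `{v l = 0}`, in terms of the dual
metric. -/
theorem dotProduct_mulVec_mul_sqrt (hA : A.PosDef) (hkl : k ≠ l) {u v : Fin m → ℝ}
    (hu0 : u k = 0) (hu1 : 0 < u l) (huu : u ⬝ᵥ A.mulVec u = 1)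
    (hu : ∀ i, i ≠ k → i ≠ l → (A.mulVec u) i = 0)
    (hv0 : v l = 0) (hv1 : 0 < v k) (hvv : v ⬝ᵥ A.mulVec v = 1)
    (hv : ∀ i, i ≠ k → i ≠ l → (A.mulVec v) i = 0) :
    (u ⬝ᵥ A.mulVec v) * √(A⁻¹ k k * A⁻¹ l l) = -A⁻¹ l k := by
  have hdot : ∀ w w' : Fin m → ℝ, (∀ i, i ≠ k → i ≠ l → (A.mulVec w') i = 0) →
      w ⬝ᵥ A.mulVec w' = w k * (A.mulVec w') k + w l * (A.mulVec w') l := fun w w' h => by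
    rw [dotProduct, Fintype.sum_eq_add k l hkl]
    intro x hx
    rw [h x hx.1 hx.2, mul_zero]
  have hs : A⁻¹ k l = A⁻¹ l k := hA.inv.isHermitian.apply l k
  have e1 := eq_of_mulVec_support hA hkl hu k
  have e2 := eq_of_mulVec_support hA hkl hu l
  have e3 := eq_of_mulVec_support hA hkl hv k
  have e4 := eq_of_mulVec_support hA hkl hv l
  rw [hdot u u hu, hu0, zero_mul, zero_add] at huu
  rw [hdot v v hv, hv0, zero_mul, add_zero] at hvv
  rw [hdot u v hv, hu0, zero_mul, zero_add]
  have hx : 0 < A⁻¹ k k := hA.inv.diag_pos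
  have hy : 0 < A⁻¹ l l := hA.inv.diag_pos
  have hΔ := hA.inv.sq_lt_mul hkl
  rw [hs] at e1 e3
  set x := A⁻¹ k k
  set y := A⁻¹ l l
  set z := A⁻¹ l k
  set a := A.mulVec u k
  set a' := A.mulVec u l
  set b := A.mulVec v k
  set b' := A.mulVec v l
  rw [hu0] at e1
  rw [hv0] at e4
  have ha' : 0 < a' := by
    by_contra h
    nlinarith [mul_nonneg hu1.le (not_lt.1 h |> neg_nonneg.2)]
  have hb : 0 < b := by
    by_contra h
    nlinarith [mul_nonneg hv1.le (not_lt.1 h |> neg_nonneg.2)]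
  have hua : x * u l = a' * (x * y - z ^ 2) := by
    linear_combination x * e2 - z * e1
  have hvb : y * v k = b * (x * y - z ^ 2) := by
    linear_combination y * e3 - z * e4
  have haΔ : a' ^ 2 * (x * y - z ^ 2) = x := by linear_combination x * huu - a' * hua
  have hbΔ : b ^ 2 * (x * y - z ^ 2) = y := by linear_combination y * hvv - b * hvb
  have hroot : b * √(x * y) = a' * y := by
    have h1 : (b * √(x * y)) ^ 2 = (a' * y) ^ 2 := by
      rw [mul_pow, Real.sq_sqrt (by positivity)]
      have h3 : (x * y - z ^ 2) * (b ^ 2 * (x * y)) = (x * y - z ^ 2) * (a' * y) ^ 2 := by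
        linear_combination x * y * hbΔ - y ^ 2 * haΔ
      exact mul_left_cancel₀ (sub_pos.2 hΔ).ne' h3
    exact (pow_left_inj₀ (by positivity) (by positivity) two_ne_zero).1 h1
  have h4 : (a' * y) * (u l * b' * √(x * y)) = (a' * y) * -z := by
    linear_combination (y * √(x * y) * b') * huu - √(x * y) * e4 - z * hroot
  exact mul_left_cancel₀ (by positivity) h4

/-- The unit vector tangent to the face `{u k = 0}`, normal to its intersection with the face
`{u l = 0}` and inward-pointing. -/
theorem exists_unit_normal (hA : A.PosDef) (hkl : k ≠ l) :
    ∃ u : Fin m → ℝ, u k = 0 ∧ 0 < u l ∧ u ⬝ᵥ A.mulVec u = 1 ∧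
      ∀ i, i ≠ k → i ≠ l → (A.mulVec u) i = 0 := by
  have hs : A⁻¹ k l = A⁻¹ l k := hA.inv.isHermitian.apply l k
  have hx : 0 < A⁻¹ k k := hA.inv.diag_pos
  have hΔ := hA.inv.sq_lt_mul hkl
  set x := A⁻¹ k k
  set y := A⁻¹ l l
  set z := A⁻¹ l k
  have hΔ' := sub_pos.2 hΔ
  -- the scale is chosen so that the vector `s (x Aⁱˡ - z Aⁱᵏ)` has norm one
  set s := (√(x * (x * y - z ^ 2)))⁻¹ with hsdef
  have hpos : 0 < x * (x * y - z ^ 2) := mul_pos hx hΔ'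
  have hs0 : 0 < s := inv_pos.2 (Real.sqrt_pos.2 hpos)
  have hss : s ^ 2 * (x * (x * y - z ^ 2)) = 1 := by
    rw [hsdef, inv_pow, Real.sq_sqrt hpos.le, inv_mul_cancel₀ hpos.ne']
  have hAu : A.mulVec (A⁻¹.mulVec (Pi.single k (-(s * z)) + Pi.single l (s * x)))
      = Pi.single k (-(s * z)) + Pi.single l (s * x) := by
    rw [Matrix.mulVec_mulVec, Matrix.mul_nonsing_inv _ (Ne.isUnit hA.det_pos.ne'),
      Matrix.one_mulVec]
  have hui : ∀ i, A⁻¹.mulVec (Pi.single k (-(s * z)) + Pi.single l (s * x)) i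
      = A⁻¹ i k * (-(s * z)) + A⁻¹ i l * (s * x) := fun i => by
    rw [Matrix.mulVec_add]; simp
  refine ⟨A⁻¹.mulVec (Pi.single k (-(s * z)) + Pi.single l (s * x)), ?_, ?_, ?_, ?_⟩
  · rw [hui, hs]
    change x * _ + z * _ = 0
    ring
  · rw [hui]
    change 0 < z * _ + y * _
    have : z * (-(s * z)) + y * (s * x) = s * (x * y - z ^ 2) := by ring
    rw [this]
    positivity
  · rw [hAu, dotProduct_add, dotProduct_single, dotProduct_single, hui, hui, hs]
    change (x * _ + z * _) * _ + (z * _ + y * _) * _ = 1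
    linear_combination hss
  · intro i hi hi'
    rw [hAu]
    simp [hi, hi']

end

section

variable {d : ℕ} {X : Type*} [TopologicalSpace X] [ChartedSpace (EuclideanQuadrant (d + 2)) X]
  {e : OpenPartialHomeomorph X (EuclideanQuadrant (d + 2))} {M Q : Set X}
  {y : EuclideanSpace ℝ (Fin (d + 2))}
  [IsManifold (cornerModel d) ∞ X]

/-- The corner angle is well defined, and its cosine is minus the cosine of the angle between the
inward conormals of `M` and `Q`. -/
theorem isCornerAngle_iff {k : ℕ∞ω} (gbar : CkMetric d X k) {x : X}
    (hA : (chartComponents e gbar.inner (e.extend (cornerModel d) x)).PosDef) {r : ℝ}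
    (hr : r * √((chartComponents e gbar.inner (e.extend (cornerModel d) x))⁻¹ 0 0
      * (chartComponents e gbar.inner (e.extend (cornerModel d) x))⁻¹
        (Fin.last (d + 1)) (Fin.last (d + 1)))
      = -(chartComponents e gbar.inner (e.extend (cornerModel d) x))⁻¹ (Fin.last (d + 1)) 0)
    (θ : ℝ) : IsCornerAngle e gbar x θ ↔ θ = Real.arccos r := by
  set l := Fin.last (d + 1) with hl
  have hl0 : (0 : Fin (d + 2)) ≠ l := by simp [hl, Fin.ext_iff]
  set A := chartComponents e gbar.inner (e.extend (cornerModel d) x) with hAdef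
  have hsqrt : √(A⁻¹ 0 0 * A⁻¹ l l) ≠ 0 :=
    (Real.sqrt_pos.2 (mul_pos hA.inv.diag_pos hA.inv.diag_pos)).ne'
  have hsym : ∀ u w : Fin (d + 2) → ℝ, u ⬝ᵥ A.mulVec w = A.mulVec u ⬝ᵥ w := fun u w => by
    rw [Matrix.dotProduct_mulVec, ← Matrix.mulVec_transpose]
    congr 2
    exact hA.isHermitian
  constructor
  · rintro ⟨u, v, ⟨hu0, hu1, huu⟩, ⟨hv0, hv1, hvv⟩, hw, rfl⟩
    simp only [chartForm_eq_dotProduct, ← hAdef, ← hl] at hu1 hv0 huu hvv hw ⊢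
    have hsupp : ∀ i, i ≠ 0 → i ≠ l → A.mulVec u.ofLp i = 0 ∧ A.mulVec v.ofLp i = 0 := by
      intro i hi hi'
      have := hw (EuclideanSpace.single i 1) (by simp [hi.symm]) (by simp [Ne.symm hi'])
      rw [hsym, hsym] at this
      simpa using this
    have := dotProduct_mulVec_mul_sqrt hA hl0 hu0 hu1 huu (fun i h h' => (hsupp i h h').1)
      hv0 hv1 hvv (fun i h h' => (hsupp i h h').2)
    rw [mul_right_cancel₀ hsqrt (this.trans hr.symm)]
  · rintro rfl
    obtain ⟨u, hu0, hu1, huu, hu⟩ := exists_unit_normal hA hl0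
    obtain ⟨v, hv0, hv1, hvv, hv⟩ := exists_unit_normal hA hl0.symm
    have hv' := fun i h h' => hv i h' h
    have := dotProduct_mulVec_mul_sqrt hA hl0 hu0 hu1 huu hu hv0 hv1 hvv hv'
    have hrr := mul_right_cancel₀ hsqrt (this.trans hr.symm)
    have hortho : ∀ u : Fin (d + 2) → ℝ, (∀ i, i ≠ 0 → i ≠ l → A.mulVec u i = 0) →
        ∀ w : Fin (d + 2) → ℝ, w 0 = 0 → w l = 0 → u ⬝ᵥ A.mulVec w = 0 := by
      intro u hu w h0 h1
      rw [hsym, dotProduct]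
      refine Finset.sum_eq_zero fun i _ => ?_
      by_cases hi : i = 0
      · rw [hi, h0, mul_zero]
      · by_cases hi' : i = l
        · rw [hi', h1, mul_zero]
        · rw [hu i hi hi', zero_mul]
    refine ⟨WithLp.toLp 2 u, WithLp.toLp 2 v, ?_⟩
    simp only [chartForm_eq_dotProduct, ← hAdef, ← hl]
    exact ⟨⟨hu0, hu1, huu⟩, ⟨hv0, hv1, hvv⟩,
      fun w h0 h1 => ⟨hortho u hu _ h0 h1, hortho v hv' _ h0 h1⟩, by rw [hrr]⟩

end

/-! ### Scaling limits of cornered asymptotically hyperbolic and of admissible metrics -/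

section

variable {d : ℕ} {V : Set (EuclideanSpace ℝ (Fin (d + 2)))}
  {G G' : EuclideanSpace ℝ (Fin (d + 2)) → Matrix (Fin (d + 2)) (Fin (d + 2)) ℝ}
  {p : EuclideanSpace ℝ (Fin (d + 2))} {A A' : Matrix (Fin (d + 2)) (Fin (d + 2)) ℝ}

theorem HasScalingLimit.add (hV : IsOpenInQuadrant V)
    (hp : ∀ᶠ t in 𝓝[>] (0 : ℝ), transversal p t ∈ V) (h : HasScalingLimit G p A)
    (h' : HasScalingLimit G' p A') (hG : ∀ i j, ContDiffOn ℝ ∞ (fun x => G x i j) V)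
    (hG' : ∀ i j, ContDiffOn ℝ ∞ (fun x => G' x i j) V) :
    HasScalingLimit (fun x => G x + G' x) p (A + A') := by
  constructor
  · intro i j
    refine ((h.tendsto i j).add (h'.tendsto i j)).congr fun t => ?_
    rw [Matrix.add_apply]; ring
  · intro k i j
    have := (h.tendsto_pderiv k i j).add (h'.tendsto_pderiv k i j)
    have e1 : (if k = 0 then -2 * (A + A') i j else 0) = (if k = 0 then -2 * A i j else 0)
        + (if k = 0 then -2 * A' i j else 0) := by
      split_ifs
      · rw [Matrix.add_apply]; ring
      · ring
    rw [e1]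
    refine this.congr' ?_
    filter_upwards [hp] with t ht
    simp only [Matrix.add_apply]
    rw [pderiv_add (hV.subset ht) ((hG i j).differentiableWithinAt_quadrant hV ht)
      ((hG' i j).differentiableWithinAt_quadrant hV ht)]
    ring

theorem HasScalingLimit.congr (hV : IsOpenInQuadrant V)
    (hp : ∀ᶠ t in 𝓝[>] (0 : ℝ), transversal p t ∈ V) (h : HasScalingLimit G p A)
    (hG : Set.EqOn G G' V) : HasScalingLimit G' p A := by
  constructor
  · intro i j
    refine (h.tendsto i j).congr' ?_
    filter_upwards [hp] with t ht
    rw [hG ht]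
  · intro k i j
    refine (h.tendsto_pderiv k i j).congr' ?_
    filter_upwards [hp] with t ht
    rw [pderiv_congr_on hV ht fun x hx => by rw [hG hx]]

end

section

variable {d : ℕ} {X : Type*} [TopologicalSpace X]
  {p : EuclideanSpace ℝ (Fin (d + 2))}

/-- The part of an adapted chart that lies off `M`. -/
theorem isOpenInQuadrant_target_inter (e : OpenPartialHomeomorph X (EuclideanQuadrant (d + 2))) :
    IsOpenInQuadrant ((e.extend (cornerModel d)).target ∩ {y | y 0 ≠ 0}) :=
  (isOpenInQuadrant_target e).inter_ne_zero (by fun_prop)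

theorem eventually_transversal_mem_inter {e : OpenPartialHomeomorph X (EuclideanQuadrant (d + 2))}
    (hp : p ∈ (e.extend (cornerModel d)).target)
    (hp0 : p 0 = 0) : ∀ᶠ t in 𝓝[>] (0 : ℝ),
      transversal p t ∈ (e.extend (cornerModel d)).target ∩ {y | y 0 ≠ 0} := by
  filter_upwards [eventually_transversal_mem (isOpenInQuadrant_target e) hp,
    self_mem_nhdsWithin] with t ht ht0
  refine ⟨ht, ?_⟩
  change transversal p t 0 ≠ 0
  rw [transversal_zero_apply hp0]
  exact ne_of_gt ht0

end

section

variable {d : ℕ} {X : Type*} [TopologicalSpace X] [ChartedSpace (EuclideanQuadrant (d + 2)) X]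
  {e : OpenPartialHomeomorph X (EuclideanQuadrant (d + 2))} {M Q : Set X}
  {p : EuclideanSpace ℝ (Fin (d + 2))} {g : BilinField d X}

variable [IsManifold (cornerModel d) ∞ X]

theorem IsMetricOff.contDiffOn_chartComponents (hg : IsMetricOff M g) (he : IsAdaptedChart M Q e)
    (i j : Fin (d + 2)) : ContDiffOn ℝ ∞ (fun y => chartComponents e g y i j)
      ((e.extend (cornerModel d)).target ∩ {y | y 0 ≠ 0}) :=
  (_root_.contDiffOn_chartComponents he.mem_maximalAtlas (by simp) hg.contMDiffOn i j).mono
    fun _ hy => ⟨hy.1, fun h => hy.2 ((he.symm_mem_M_iff hy.1).1 h)⟩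

theorem IsMetricOff.eventually_posDef (hg : IsMetricOff M g) (he : IsAdaptedChart M Q e)
    (hp : p ∈ (e.extend (cornerModel d)).target) (hp0 : p 0 = 0) :
    ∀ᶠ t in 𝓝[>] (0 : ℝ), (chartComponents e g (transversal p t)).PosDef := by
  filter_upwards [eventually_transversal_mem_inter hp hp0] with t ht
  exact hg.posDef_chartComponents he.mem_maximalAtlas ht.1
    fun h => ht.2 ((he.symm_mem_M_iff ht.1).1 h)

theorem IsCAHMetric.exists_scalingLimit (hg : IsCAHMetric ∞ M g) (he : IsAdaptedChart M Q e)
    (hp : p ∈ (e.extend (cornerModel d)).target) (hp0 : p 0 = 0) :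
    ∃ A : Matrix (Fin (d + 2)) (Fin (d + 2)) ℝ, A.PosDef ∧ A⁻¹ 0 0 = 1 ∧
      HasScalingLimit (chartComponents e g) p A := by
  obtain ⟨φ, gbar, hφ, hcomp, hunit⟩ := hg.asymptotically_hyperbolic
  have hpos := posDef_chartComponents_inner gbar he.mem_maximalAtlas hp
  have hc := hφ.pderiv_chart_ne_zero he hp hp0
  have h1 := HasUnitDifferential.chart hφ he hp hp0 (hunit _ ((he.symm_mem_M_iff hp).2 hp0))
  refine ⟨(pderiv 0 (fun y => φ ((e.extend (cornerModel d)).symm y)) p ^ 2)⁻¹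
    • chartComponents e gbar.inner p, hpos.smul (by positivity), ?_, ?_⟩
  · rw [Matrix.inv_smul_apply hpos.det_pos.ne' (by positivity), inv_inv, h1]
  · refine hasScalingLimit_of_compactification (isOpenInQuadrant_target e) hp hp0
      (contDiffOn_chartComponents_inner gbar (by simp) he.mem_maximalAtlas)
      (hφ.contDiffOn_chart he.mem_maximalAtlas)
      (fun x hx => (hφ.eq_zero_iff _).trans (he.symm_mem_M_iff hx)) hc fun x hx hx0 => ?_
    exact hcomp.chartComponents_eq fun h => hx0 ((he.symm_mem_M_iff hx).1 h)

theorem IsAdmissible.exists_scalingLimit (hg : IsAdmissible M Q g) (he : IsAdaptedChart M Q e)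
    (hp : p ∈ (e.extend (cornerModel d)).target) (hp0 : p 0 = 0)
    (hpl : p (Fin.last (d + 1)) = 0) :
    ∃ A : Matrix (Fin (d + 2)) (Fin (d + 2)) ℝ, A.PosDef ∧ A⁻¹ 0 0 = 1 ∧
      HasScalingLimit (chartComponents e g) p A := by
  obtain ⟨gplus, L, hplus, hsum, hL⟩ := hg.exists_smooth
  obtain ⟨A, hA, hA1, hlim⟩ := hplus.exists_scalingLimit he hp hp0
  obtain ⟨B, hB, hB0⟩ := hL e he
  have hV := isOpenInQuadrant_target_inter e
  have hVm := eventually_transversal_mem_inter hp hp0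
  have heq : Set.EqOn (fun y => chartComponents e gplus y + chartComponents e L y)
      (chartComponents e g) ((e.extend (cornerModel d)).target ∩ {y | y 0 ≠ 0}) := by
    intro y hy
    ext i j
    have h := hsum _ fun h => hy.2 ((he.symm_mem_M_iff hy.1).1 h)
    simp only [chartComponents, chartForm, Matrix.add_apply, h]
    rfl
  have hLs : ∀ i j, ContDiffOn ℝ ∞ (fun y => chartComponents e L y i j)
      ((e.extend (cornerModel d)).target ∩ {y | y 0 ≠ 0}) := fun i j => by
    refine ((hg.isMetricOff.contDiffOn_chartComponents he i j).sub
      (hplus.isMetricOff.contDiffOn_chartComponents he i j)).congr fun y hy => ?_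
    have := congrFun (congrFun (heq hy) i) j
    simp only [Matrix.add_apply] at this
    linarith
  have hL0 := hB.hasScalingLimit_zero he hp hp0 hpl (fun z hz h => hB0 z hz (Or.inr h))
    fun y hy hy0 i j => (hLs i j).differentiableWithinAt_quadrant hV ⟨hy, hy0⟩
  have h := hlim.add hV hVm hL0 (hplus.isMetricOff.contDiffOn_chartComponents he) hLs
  rw [add_zero] at h
  exact ⟨A, hA, hA1, h.congr hV hVm heq⟩

/-- Near the corner `g` is asymptotic to a hyperbolic metric whose Riemannian angle is determined by
`lam`. -/
theorem exists_scalingLimit_lam (hg : IsCAHMetric ∞ M g ∨ IsAdmissible M Q g)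
    (he : IsAdaptedChart M Q e) {lam : ℝ} (hQ : HasUmbilicBoundary M Q g lam)
    (hp : p ∈ (e.extend (cornerModel d)).target) (hp0 : p 0 = 0)
    (hpl : p (Fin.last (d + 1)) = 0) :
    ∃ A : Matrix (Fin (d + 2)) (Fin (d + 2)) ℝ, A.PosDef ∧ A⁻¹ 0 0 = 1 ∧
      lam * √(A⁻¹ (Fin.last (d + 1)) (Fin.last (d + 1))) = A⁻¹ (Fin.last (d + 1)) 0 ∧
      HasScalingLimit (chartComponents e g) p A := by
  have hmet : IsMetricOff M g := hg.elim (fun h => h.isMetricOff) fun h => h.isMetricOff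
  obtain ⟨A, hA, hA1, hlim⟩ := hg.elim (fun h => h.exists_scalingLimit he hp hp0)
    fun h => h.exists_scalingLimit he hp hp0 hpl
  have h0l : (0 : Fin (d + 2)) ≠ Fin.last (d + 1) := by simp [Fin.ext_iff]
  refine ⟨A, hA, hA1, hlim.lam_mul_sqrt hA (hmet.eventually_posDef he hp hp0) ?_, hlim⟩
  filter_upwards [eventually_transversal_mem_inter hp hp0] with t ht
  refine hQ e he _ ht.1 ((he.symm_mem_Q_iff ht.1).2 ?_)
    (fun h => ht.2 ((he.symm_mem_M_iff ht.1).1 h)) 0 0 h0l h0l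
  rw [transversal_apply_of_ne h0l.symm, hpl]

theorem lam_mem_Ioo {A : Matrix (Fin (d + 2)) (Fin (d + 2)) ℝ} (hA : A.PosDef)
    (hA1 : A⁻¹ 0 0 = 1) {lam : ℝ}
    (hlam : lam * √(A⁻¹ (Fin.last (d + 1)) (Fin.last (d + 1))) = A⁻¹ (Fin.last (d + 1)) 0) :
    lam ∈ Set.Ioo (-1 : ℝ) 1 := by
  have h0l : (0 : Fin (d + 2)) ≠ Fin.last (d + 1) := by simp [Fin.ext_iff]
  have h := hA.inv.sq_lt_mul h0l
  have hy : 0 < A⁻¹ (Fin.last (d + 1)) (Fin.last (d + 1)) := hA.inv.diag_pos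
  rw [hA1, one_mul, ← hlam, mul_pow, Real.sq_sqrt hy.le] at h
  have h1 : lam ^ 2 < 1 := by
    by_contra hc
    nlinarith [not_lt.1 hc]
  exact abs_lt.1 ((sq_lt_one_iff_abs_lt_one lam).1 h1)

/-- All continuous compactifications of `g` agree at the corner, up to a factor, with the scaling
limit. -/
theorem IsCompactification.chartComponents_eq_smul {φ : X → ℝ} {gbar : CkMetric d X 0}
    (hφ : IsDefiningFunction (d := d) M φ) (hcomp : IsCompactification M g φ gbar)
    (he : IsAdaptedChart M Q e) (hp : p ∈ (e.extend (cornerModel d)).target) (hp0 : p 0 = 0)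
    {A : Matrix (Fin (d + 2)) (Fin (d + 2)) ℝ} (hlim : HasScalingLimit (chartComponents e g) p A) :
    chartComponents e gbar.inner p
      = pderiv 0 (fun y => φ ((e.extend (cornerModel d)).symm y)) p ^ 2 • A := by
  have hU := isOpenInQuadrant_target e
  ext i j
  have h1 := (contDiffOn_chartComponents_inner gbar (by simp) he.mem_maximalAtlas
    i j).tendsto_transversal hU hp
  have h2 := tendsto_div_transversal (hU.subset hp)
    ((hφ.contDiffOn_chart he.mem_maximalAtlas).differentiableWithinAt_quadrant hU hp)
    ((hφ.eq_zero_iff _).2 ((he.symm_mem_M_iff hp).2 hp0))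
  refine tendsto_nhds_unique h1 (((h2.pow 2).mul (hlim.tendsto i j)).congr' ?_)
  filter_upwards [eventually_transversal_mem_inter hp hp0, self_mem_nhdsWithin] with t ht ht0
  rw [hcomp.chartComponents_eq fun h => ht.2 ((he.symm_mem_M_iff ht.1).1 h)]
  have : t ≠ 0 := ne_of_gt ht0
  simp only [Matrix.smul_apply, smul_eq_mul]
  field_simp

theorem exists_cornerAngle (hg : IsCAHMetric ∞ M g ∨ IsAdmissible M Q g) {lam : ℝ}
    (hQ : HasUmbilicBoundary M Q g lam) {φ : X → ℝ} {gbar : CkMetric d X 0}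
    (hφ : IsDefiningFunction (d := d) M φ) (hcomp : IsCompactification M g φ gbar) {x : X}
    (hx : x ∈ M ∩ Q) (he : IsAdaptedChart M Q e) (hxe : x ∈ e.source) :
    ∃ θ₀ : ℝ, (∀ θ : ℝ, IsCornerAngle e gbar x θ ↔ θ = θ₀) ∧ Real.cos θ₀ = -lam := by
  have hp : e.extend (cornerModel d) x ∈ (e.extend (cornerModel d)).target :=
    (e.extend (cornerModel d)).map_source (by rwa [e.extend_source])
  have hp0 : e.extend (cornerModel d) x 0 = 0 := (he.mem_M_iff x hxe).1 hx.1
  have hpl : e.extend (cornerModel d) x (Fin.last (d + 1)) = 0 := (he.mem_Q_iff x hxe).1 hx.2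
  obtain ⟨A, hA, hA1, hlam, hlim⟩ := exists_scalingLimit_lam hg he hQ hp hp0 hpl
  have hbar := hcomp.chartComponents_eq_smul hφ he hp hp0 hlim
  have hc := hφ.pderiv_chart_ne_zero he hp hp0
  set c := pderiv 0 (fun y => φ ((e.extend (cornerModel d)).symm y)) (e.extend (cornerModel d) x)
  obtain ⟨h1, h2⟩ := lam_mem_Ioo hA hA1 hlam
  refine ⟨Real.arccos (-lam), isCornerAngle_iff gbar
    (posDef_chartComponents_inner gbar he.mem_maximalAtlas hp) ?_,
    Real.cos_arccos (by linarith) (by linarith)⟩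
  have hc2 : c ^ 2 ≠ 0 := by positivity
  rw [hbar, Matrix.inv_smul_apply hA.det_pos.ne' hc2, Matrix.inv_smul_apply hA.det_pos.ne' hc2,
    Matrix.inv_smul_apply hA.det_pos.ne' hc2, hA1, ← hlam]
  rw [show (c ^ 2)⁻¹ * 1 * ((c ^ 2)⁻¹ * A⁻¹ (Fin.last (d + 1)) (Fin.last (d + 1)))
    = ((c ^ 2)⁻¹) ^ 2 * A⁻¹ (Fin.last (d + 1)) (Fin.last (d + 1)) by ring,
    Real.sqrt_mul (by positivity), Real.sqrt_sq (by positivity)]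
  ring

end

/-! ### Umbilicity of the faces for the compactified metric -/

/-- A limit of multiples is a multiple of the limit, if the latter does not vanish. -/
theorem exists_eq_mul_of_tendsto {ι : Type*} {s : Set ι} {E H : ℝ → ι → ℝ} {E₀ H₀ : ι → ℝ}
    (hE : ∀ i ∈ s, Tendsto (fun t => E t i) (𝓝[>] 0) (𝓝 (E₀ i)))
    (hH : ∀ i ∈ s, Tendsto (fun t => H t i) (𝓝[>] 0) (𝓝 (H₀ i)))
    (h : ∀ᶠ t in 𝓝[>] (0 : ℝ), ∃ c : ℝ, ∀ i ∈ s, E t i = c * H t i)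
    {a : ι} (ha : a ∈ s) (ha0 : H₀ a ≠ 0) : ∃ c : ℝ, ∀ i ∈ s, E₀ i = c * H₀ i := by
  refine ⟨E₀ a / H₀ a, fun i hi => ?_⟩
  have h1 : Tendsto (fun t => E t a / H t a * H t i) (𝓝[>] 0) (𝓝 (E₀ a / H₀ a * H₀ i)) :=
    ((hE a ha).div (hH a ha) ha0).mul (hH i hi)
  refine tendsto_nhds_unique (hE i hi) (h1.congr' ?_)
  filter_upwards [h, (hH a ha).eventually_ne ha0] with t ⟨c, hc⟩ ht
  rw [hc a ha, hc i hi, mul_div_assoc, div_self ht, mul_one]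

theorem ricci_congr_on {m : ℕ} {U : Set (EuclideanSpace ℝ (Fin m))}
    {G G' : EuclideanSpace ℝ (Fin m) → Matrix (Fin m) (Fin m) ℝ}
    (hU : IsOpenInQuadrant U) {y : EuclideanSpace ℝ (Fin m)} (hy : y ∈ U) (h : Set.EqOn G G' U)
    (i j : Fin m) : ricci G i j y = ricci G' i j y := by
  have h1 : ∀ x ∈ U, ∀ k i j, christoffel G k i j x = christoffel G' k i j x :=
    fun x hx => christoffel_congr_on hU hx h
  have h2 : ∀ k i j c, pderiv c (christoffel G k i j) y = pderiv c (christoffel G' k i j) y :=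
    fun k i j => pderiv_congr_on hU hy fun x hx => h1 x hx k i j
  simp only [ricci, h1 y hy, h2]

section

variable {d : ℕ} {U : Set (EuclideanSpace ℝ (Fin (d + 2)))}
  {G Gbar : EuclideanSpace ℝ (Fin (d + 2)) → Matrix (Fin (d + 2)) (Fin (d + 2)) ℝ}
  {φ : EuclideanSpace ℝ (Fin (d + 2)) → ℝ} {p : EuclideanSpace ℝ (Fin (d + 2))}

/-- If the second fundamental form of `Q` is pure trace with respect to `φ⁻² Gbar`, then it is so
with respect to `Gbar`, up to the corner. -/
theorem exists_christoffel_last_eq_mul (hU : IsOpenInQuadrant U) (hp : p ∈ U) (hp0 : p 0 = 0)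
    (hGbar : ∀ i j, ContDiffOn ℝ ∞ (fun x => Gbar x i j) U)
    (hpos : ∀ x ∈ U, (Gbar x).PosDef) (hφ : ContDiffOn ℝ ∞ φ U)
    (hφ0 : ∀ x ∈ U, φ x = 0 ↔ x 0 = 0)
    (hG : ∀ x ∈ U, x 0 ≠ 0 → Gbar x = φ x ^ 2 • G x) {lam : ℝ}
    (hK : ∀ᶠ t in 𝓝[>] (0 : ℝ), ∀ i j, i ≠ Fin.last (d + 1) → j ≠ Fin.last (d + 1) →
      secondFundForm G (Fin.last (d + 1)) i j (transversal p t)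
        = lam * G (transversal p t) i j) :
    ∃ c : ℝ, ∀ i j, i ≠ Fin.last (d + 1) → j ≠ Fin.last (d + 1) →
      christoffel Gbar (Fin.last (d + 1)) i j p = c * Gbar p i j := by
  set l := Fin.last (d + 1) with hl
  have h0l : (0 : Fin (d + 2)) ≠ l := by simp [hl, Fin.ext_iff]
  have hV := hU.inter_ne_zero hφ.continuousOn
  set V := U ∩ {x | φ x ≠ 0}
  have hdet : ∀ x ∈ U, (Gbar x).det ≠ 0 := fun x hx => (hpos x hx).det_pos.ne'
  have hsym : ∀ x ∈ U, (Gbar x).IsSymm := fun x hx => by simpa using (hpos x hx).isHermitian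
  have hC := ContDiffOn.christoffel hU hGbar hdet
  have hu : ContDiffOn ℝ ∞ (fun x => (φ x ^ 2)⁻¹) V :=
    ((hφ.mono Set.inter_subset_left).pow 2).inv fun x hx => pow_ne_zero 2 hx.2
  have hGV : Set.EqOn G (fun x => (φ x ^ 2)⁻¹ • Gbar x) V := fun x hx => by
    have hx0 : φ x ^ 2 ≠ 0 := pow_ne_zero 2 hx.2
    simp only
    rw [hG x hx.1 fun h => hx.2 ((hφ0 x hx.1).2 h), smul_smul, inv_mul_cancel₀ hx0, one_smul]
  obtain ⟨c, hc⟩ := exists_eq_mul_of_tendsto (ι := Fin (d + 2) × Fin (d + 2))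
    (s := {q | q.1 ≠ l ∧ q.2 ≠ l})
    (E := fun t q => christoffel Gbar l q.1 q.2 (transversal p t))
    (H := fun t q => Gbar (transversal p t) q.1 q.2)
    (fun q _ => (hC l q.1 q.2).tendsto_transversal hU hp)
    (fun q _ => (hGbar q.1 q.2).tendsto_transversal hU hp) (by
      filter_upwards [hK, eventually_transversal_mem hU hp, self_mem_nhdsWithin] with t ht htU ht0
      have htV : transversal p t ∈ V := ⟨htU, fun h => by
        rw [hφ0 _ htU, transversal_zero_apply hp0] at h
        exact (ne_of_gt ht0) h⟩
      have hu0 : (φ (transversal p t) ^ 2)⁻¹ ≠ 0 := inv_ne_zero (pow_ne_zero 2 htV.2)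
      have hupos : 0 < (φ (transversal p t) ^ 2)⁻¹ :=
        lt_of_le_of_ne (by positivity) hu0.symm
      have hGpos : (G (transversal p t)).PosDef := by
        rw [hGV htV]; exact (hpos _ htU).smul hupos
      set S := ∑ k, (Gbar (transversal p t))⁻¹ l k
        * (pderiv k (fun x => (φ x ^ 2)⁻¹) (transversal p t)
          / (2 * (φ (transversal p t) ^ 2)⁻¹)) with hS
      refine ⟨lam * √((G (transversal p t))⁻¹ l l) * (φ (transversal p t) ^ 2)⁻¹ + S,
        fun q hq => ?_⟩
      have h1 := ht q.1 q.2 hq.1 hq.2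
      rw [secondFundForm_eq (by simpa using hGpos.isHermitian) hGpos.det_pos.ne',
        div_eq_iff (Real.sqrt_pos.2 hGpos.inv.diag_pos).ne', christoffel_congr_on hV htV hGV,
        christoffel_smul hV htV (fun i j => (hGbar i j).mono Set.inter_subset_left)
          (fun x hx => hsym x hx.1) (hdet _ htU) hu hu0, if_neg hq.1.symm, if_neg hq.2.symm,
        ← hS] at h1
      have h2 : G (transversal p t) q.1 q.2
          = (φ (transversal p t) ^ 2)⁻¹ * Gbar (transversal p t) q.1 q.2 := by
        rw [hGV htV]; rfl
      rw [h2] at h1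
      linear_combination h1) (a := (0, 0)) ⟨h0l, h0l⟩ (hpos p hp).diag_pos.ne'
  exact ⟨c, fun i j hi hj => hc (i, j) ⟨hi, hj⟩⟩

/-- If `φ⁻² Gbar` is Einstein, then the second fundamental form of `M` with respect to `Gbar` is pure
trace: up to multiples of `Gbar`, the leading term of the Einstein equation at `M` is `d` times the
Hessian of `φ`. -/
theorem exists_christoffel_zero_eq_mul (hd : 1 ≤ d) (hU : IsOpenInQuadrant U) (hp : p ∈ U)
    (hp0 : p 0 = 0) (hGbar : ∀ i j, ContDiffOn ℝ ∞ (fun x => Gbar x i j) U)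
    (hpos : ∀ x ∈ U, (Gbar x).PosDef) (hφ : ContDiffOn ℝ ∞ φ U)
    (hφ0 : ∀ x ∈ U, φ x = 0 ↔ x 0 = 0) (hc : pderiv 0 φ p ≠ 0)
    (hG : ∀ x ∈ U, x 0 ≠ 0 → Gbar x = φ x ^ 2 • G x) {mu : ℝ}
    (hE : ∀ᶠ t in 𝓝[>] (0 : ℝ), ∀ i j,
      ricci G i j (transversal p t) = mu * G (transversal p t) i j) :
    ∃ c : ℝ, ∀ i j, i ≠ 0 → j ≠ 0 → christoffel Gbar 0 i j p = c * Gbar p i j := by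
  have hV := hU.inter_ne_zero hφ.continuousOn
  set V := U ∩ {x | φ x ≠ 0}
  have hVU : V ⊆ U := Set.inter_subset_left
  have hdet : ∀ x ∈ U, (Gbar x).det ≠ 0 := fun x hx => (hpos x hx).det_pos.ne'
  have hsym : ∀ x ∈ U, (Gbar x).IsSymm := fun x hx => by simpa using (hpos x hx).isHermitian
  have hC := ContDiffOn.christoffel hU hGbar hdet
  have hR := ContDiffOn.ricci hU hGbar hdet
  set u : EuclideanSpace ℝ (Fin (d + 2)) → ℝ := fun x => (φ x ^ 2)⁻¹ with hudef
  have hu : ContDiffOn ℝ ∞ u V := ((hφ.mono hVU).pow 2).inv fun x hx => pow_ne_zero 2 hx.2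
  have hu0 : ∀ x ∈ V, u x ≠ 0 := fun x hx => inv_ne_zero (pow_ne_zero 2 hx.2)
  have hGV : Set.EqOn G (fun x => u x • Gbar x) V := fun x hx => by
    have hx0 : φ x ^ 2 ≠ 0 := pow_ne_zero 2 hx.2
    simp only [hudef]
    rw [hG x hx.1 fun h => hx.2 ((hφ0 x hx.1).2 h), smul_smul, inv_mul_cancel₀ hx0, one_smul]
  set f : Fin (d + 2) → EuclideanSpace ℝ (Fin (d + 2)) → ℝ := fun i x =>
    pderiv i u x / (2 * u x) with hf
  have hφd : ∀ x ∈ V, DifferentiableWithinAt ℝ φ (quadrant (d + 2)) x := fun x hx =>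
    hφ.differentiableWithinAt_quadrant hU hx.1
  have hinv : ContDiffOn ℝ ∞ (fun x => (φ x)⁻¹) V := (hφ.mono hVU).inv fun x hx => hx.2
  have hfV : ∀ i, Set.EqOn (f i) (fun x => (-1) * ((φ x)⁻¹ * pderiv i φ x)) V := fun i x hx => by
    have hx0 : φ x ≠ 0 := hx.2
    have h1 : pderiv i u x = -(pderiv i φ x * φ x + φ x * pderiv i φ x) / (φ x * φ x) ^ 2 := by
      have h2 : u = fun x => (φ x * φ x)⁻¹ := by funext x; rw [hudef]; simp only [pow_two]
      rw [h2, pderiv_inv (f := fun x => φ x * φ x) (hV.subset hx) ((hφd x hx).fun_mul (hφd x hx))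
        (mul_ne_zero hx0 hx0), pderiv_mul (hV.subset hx) (hφd x hx) (hφd x hx)]
    simp only [hf]
    rw [h1]
    simp only [hudef]
    field_simp
    ring
  have hdf : ∀ x ∈ V, ∀ i j, pderiv i (f j) x
      = pderiv i φ x * pderiv j φ x / φ x ^ 2 - pderiv i (pderiv j φ) x / φ x :=
    fun x hx i j => by
      have hx0 : φ x ≠ 0 := hx.2
      have hi := hinv.differentiableWithinAt_quadrant hV hx
      have hj := (hφ.pderiv hU j).differentiableWithinAt_quadrant hU hx.1
      rw [pderiv_congr_on hV hx (hfV j), pderiv_mul (hV.subset hx) (differentiableWithinAt_const _)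
        (hi.fun_mul hj), pderiv_mul (hV.subset hx) hi hj, pderiv_const,
        pderiv_inv (hV.subset hx) (hφd x hx) hx0]
      field_simp
      ring
  -- the Einstein equation, multiplied by `φ`, up to multiples of `Gbar`
  have hlim : ∀ i j, Tendsto (fun t => φ (transversal p t) * ricci Gbar i j (transversal p t)
        - pderiv i (pderiv j φ) (transversal p t)
        + (d + 1) * pderiv j (pderiv i φ) (transversal p t)
        - d * ∑ k, pderiv k φ (transversal p t) * christoffel Gbar k i j (transversal p t))
      (𝓝[>] 0) (𝓝 (φ p * ricci Gbar i j p - pderiv i (pderiv j φ) p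
        + (d + 1) * pderiv j (pderiv i φ) p
        - d * ∑ k, pderiv k φ p * christoffel Gbar k i j p)) := fun i j =>
    ((((hφ.tendsto_transversal hU hp).mul ((hR i j).tendsto_transversal hU hp)).sub
      (((hφ.pderiv hU j).pderiv hU i).tendsto_transversal hU hp)).add
      ((((hφ.pderiv hU i).pderiv hU j).tendsto_transversal hU hp).const_mul _)).sub
      ((tendsto_finsetSum _ fun k _ => ((hφ.pderiv hU k).tendsto_transversal hU hp).mul
        ((hC k i j).tendsto_transversal hU hp)).const_mul _)
  obtain ⟨c, hcc⟩ := exists_eq_mul_of_tendsto (ι := Fin (d + 2) × Fin (d + 2))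
    (s := Set.univ) (fun q _ => hlim q.1 q.2)
    (H := fun t q => Gbar (transversal p t) q.1 q.2)
    (fun q _ => (hGbar q.1 q.2).tendsto_transversal hU hp) (by
      filter_upwards [hE, eventually_transversal_mem hU hp, self_mem_nhdsWithin] with t ht htU ht0
      have htV : transversal p t ∈ V := ⟨htU, fun h => by
        rw [hφ0 _ htU, transversal_zero_apply hp0] at h
        exact (ne_of_gt ht0) h⟩
      obtain ⟨s, hs⟩ := exists_ricci_smul hV htV (fun i j => (hGbar i j).mono hVU)
        (fun x hx => hsym x hx.1) (fun x hx => hdet x hx.1) hu hu0 f fun i x => rfl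
      set y := transversal p t
      have hy0 : φ y ≠ 0 := htV.2
      refine ⟨φ y * (mu * u y - s), fun q _ => ?_⟩
      have h1 := ht q.1 q.2
      have h2 : G y q.1 q.2 = u y * Gbar y q.1 q.2 := by rw [hGV htV]; rfl
      have h3 : ∑ k, f k y * christoffel Gbar k q.1 q.2 y
          = (-1) * ((φ y)⁻¹ * ∑ k, pderiv k φ y * christoffel Gbar k q.1 q.2 y) := by
        rw [Finset.mul_sum, Finset.mul_sum]
        refine Finset.sum_congr rfl fun k _ => ?_
        rw [hfV k htV]; ring
      rw [ricci_congr_on hV htV hGV, hs, hdf y htV, hdf y htV, h3, hfV _ htV, hfV _ htV, h2] at h1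
      push_cast at h1
      linear_combination (norm := (field_simp; ring)) φ y * h1) (a := (0, 0)) (Set.mem_univ _) (hpos p hp).diag_pos.ne'
  have hφp : φ p = 0 := (hφ0 p hp).2 hp0
  have hface : ∀ x ∈ U, x 0 = 0 → ∀ k, k ≠ 0 → pderiv k φ x = 0 := fun x hx hx0 k hk =>
    pderiv_eq_zero_of_eqOn_face hU hx (hφ.differentiableWithinAt_quadrant hU hx) hk hx0
      fun z hz => (hφ0 z hz).2
  -- `φ` vanishes on `M`, so its Hessian in coordinates vanishes on `TM` and only `Γ⁰` is left
  have hface2 : ∀ i j, i ≠ 0 → j ≠ 0 → pderiv i (pderiv j φ) p = 0 := fun i j hi hj =>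
    pderiv_eq_zero_of_eqOn_face hU hp ((hφ.pderiv hU j).differentiableWithinAt_quadrant hU hp) hi
      hp0 fun z hz hz0 => hface z hz hz0 j hj
  have hd0 : (d : ℝ) ≠ 0 := by positivity
  refine ⟨-c / (d * pderiv 0 φ p), fun i j hi hj => ?_⟩
  have h1 := hcc (i, j) (Set.mem_univ _)
  have h2 : ∑ k, pderiv k φ p * christoffel Gbar k i j p
      = pderiv 0 φ p * christoffel Gbar 0 i j p := by
    refine Fintype.sum_eq_single 0 fun k hk => ?_
    rw [hface p hp hp0 k hk, zero_mul]
  simp only [hφp, hface2 i j hi hj, hface2 j i hj hi, h2] at h1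
  field_simp
  linear_combination -h1

end

/-! ### Restriction to `M` -/

section

variable {d : ℕ} {U : Set (EuclideanSpace ℝ (Fin (d + 2)))}

theorem faceM_zero (y : EuclideanSpace ℝ (Fin (d + 1))) : faceM y 0 = 0 := rfl

theorem faceM_succ (y : EuclideanSpace ℝ (Fin (d + 1))) (i : Fin (d + 1)) :
    faceM y i.succ = y i := rfl

variable (d) in
/-- The parametrization of the face `M` as a linear map. -/
noncomputable def faceMCLM : EuclideanSpace ℝ (Fin (d + 1)) →L[ℝ] EuclideanSpace ℝ (Fin (d + 2)) :=
  LinearMap.toContinuousLinearMap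
    { toFun := faceM
      map_add' := fun x y => by
        ext i
        refine Fin.cases ?_ (fun i => ?_) i
        · simp [faceM_zero]
        · simp [faceM_succ]
      map_smul' := fun c y => by
        ext i
        refine Fin.cases ?_ (fun i => ?_) i
        · simp [faceM_zero]
        · simp [faceM_succ] }

theorem faceMCLM_apply (y : EuclideanSpace ℝ (Fin (d + 1))) : faceMCLM d y = faceM y := rfl

theorem contDiff_faceM : ContDiff ℝ ∞ (faceM (d := d)) := (faceMCLM d).contDiff

theorem faceM_single (c : Fin (d + 1)) :
    faceM (EuclideanSpace.single c (1 : ℝ)) = EuclideanSpace.single c.succ 1 := by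
  ext i
  refine Fin.cases ?_ (fun i => ?_) i
  · simp [faceM_zero]
  · simp [faceM_succ, PiLp.single_apply]

theorem faceM_mem_quadrant {y : EuclideanSpace ℝ (Fin (d + 1))} :
    faceM y ∈ quadrant (d + 2) ↔ y ∈ quadrant (d + 1) := by
  refine ⟨fun h i => h i.succ, fun h i => ?_⟩
  refine Fin.cases ?_ (fun i => ?_) i
  · rw [faceM_zero]
  · exact h i

theorem IsOpenInQuadrant.faceM (hU : IsOpenInQuadrant U) : IsOpenInQuadrant (faceM ⁻¹' U) where
  subset y hy := faceM_mem_quadrant.1 (hU.subset hy)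
  mem_nhdsWithin y hy := by
    have h : Tendsto _root_.faceM (𝓝[quadrant (d + 1)] y) (𝓝[quadrant (d + 2)] (_root_.faceM y)) :=
      tendsto_nhdsWithin_iff.2 ⟨((contDiff_faceM (d := d)).continuous.tendsto y).mono_left
        nhdsWithin_le_nhds, eventually_mem_nhdsWithin.mono fun z hz => faceM_mem_quadrant.2 hz⟩
    exact h (hU.mem_nhdsWithin _ hy)

theorem pderiv_comp_faceM {f : EuclideanSpace ℝ (Fin (d + 2)) → ℝ}
    {y : EuclideanSpace ℝ (Fin (d + 1))} (hy : y ∈ quadrant (d + 1))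
    (hf : DifferentiableWithinAt ℝ f (quadrant (d + 2)) (faceM y)) (c : Fin (d + 1)) :
    pderiv c (fun x => f (faceM x)) y = pderiv c.succ f (faceM y) := by
  have h := hf.hasFDerivWithinAt.comp y ((faceMCLM d).hasFDerivWithinAt (s := quadrant (d + 1)))
    fun z hz => faceM_mem_quadrant.2 hz
  unfold pderiv
  rw [HasFDerivWithinAt.fderivWithin (f := fun x => f (faceM x)) h
    (uniqueDiffOn_quadrant _ y hy)]
  simp [faceMCLM_apply, faceM_single]

/-- If the Christoffel symbols that give the second fundamental forms of `M` and of `Q` are pure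
trace on `TS`, then so are those that give the second fundamental form of `S` in `M`: the normal of
`S` in `M` is a combination of the normals of `M` and of `Q`. -/
theorem exists_christoffel_face_eq_mul
    {G : EuclideanSpace ℝ (Fin (d + 2)) → Matrix (Fin (d + 2)) (Fin (d + 2)) ℝ}
    (hU : IsOpenInQuadrant U) (hG : ∀ i j, ContDiffOn ℝ ∞ (fun x => G x i j) U)
    (hpos : ∀ x ∈ U, (G x).PosDef) {y : EuclideanSpace ℝ (Fin (d + 1))} (hy : faceM y ∈ U)
    {c c' : ℝ}
    (h0 : ∀ i j, i ≠ 0 → j ≠ 0 → christoffel G 0 i j (faceM y) = c * G (faceM y) i j)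
    (hl : ∀ i j, i ≠ Fin.last (d + 1) → j ≠ Fin.last (d + 1) →
      christoffel G (Fin.last (d + 1)) i j (faceM y) = c' * G (faceM y) i j) :
    ∃ η : ℝ, ∀ a b, a ≠ Fin.last d → b ≠ Fin.last d →
      christoffel (fun x => (G (faceM x)).submatrix Fin.succ Fin.succ) (Fin.last d) a b y
        = η * G (faceM y) a.succ b.succ := by
  have hdet : (G (faceM y)).det ≠ 0 := (hpos _ hy).det_pos.ne'
  set H := (G (faceM y)).submatrix Fin.succ Fin.succ with hH
  have hHdet : H.det ≠ 0 := ((hpos _ hy).submatrix (Fin.succ_injective _)).det_pos.ne'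
  have hpd : ∀ a b k, pderiv k (fun x => (G (faceM x)).submatrix Fin.succ Fin.succ a b) y
      = pderiv k.succ (fun x => G x a.succ b.succ) (faceM y) := fun a b k =>
    pderiv_comp_faceM (f := fun x => G x a.succ b.succ) (faceM_mem_quadrant.1 (hU.subset hy))
      ((hG a.succ b.succ).differentiableWithinAt_quadrant hU hy) k
  -- pairing with the normal of `S` in `M` is, up to a factor, the covector `β dy⁰ + dyˡ` of `X`
  set β := ∑ k, H⁻¹ (Fin.last d) k * G (faceM y) k.succ 0 with hβ
  refine ⟨β * c + c', fun a b ha hb => ?_⟩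
  have ha' : a.succ ≠ Fin.last (d + 1) := by
    rw [← Fin.succ_last]; exact fun h => ha (Fin.succ_injective _ h)
  have hb' : b.succ ≠ Fin.last (d + 1) := by
    rw [← Fin.succ_last]; exact fun h => hb (Fin.succ_injective _ h)
  have h1 : christoffel (fun x => (G (faceM x)).submatrix Fin.succ Fin.succ) (Fin.last d) a b y
      = ∑ k, H⁻¹ (Fin.last d) k
        * ∑ j, G (faceM y) k.succ j * christoffel G j a.succ b.succ (faceM y) := by
    rw [christoffel, Finset.mul_sum]
    refine Finset.sum_congr rfl fun k _ => ?_
    rw [sum_mul_christoffel hdet, hpd, hpd, hpd]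
    ring
  have h2 : ∑ k, H⁻¹ (Fin.last d) k * ∑ j : Fin (d + 1), G (faceM y) k.succ j.succ
        * christoffel G j.succ a.succ b.succ (faceM y)
      = christoffel G (Fin.last (d + 1)) a.succ b.succ (faceM y) := by
    simp only [Finset.mul_sum]
    rw [Finset.sum_comm]
    simp only [← mul_assoc, ← Finset.sum_mul]
    have : ∀ j, ∑ k, H⁻¹ (Fin.last d) k * G (faceM y) k.succ j.succ
        = if Fin.last d = j then 1 else 0 := fun j => Matrix.sum_nonsing_inv_mul hHdet _ j
    simp [this]
  rw [h1]
  simp only [Fin.sum_univ_succ (n := d + 1), mul_add, Finset.sum_add_distrib]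
  rw [h2, hl _ _ ha' hb', h0 _ _ (Fin.succ_ne_zero a) (Fin.succ_ne_zero b)]
  simp only [← mul_assoc, ← Finset.sum_mul]
  rw [← hβ]
  ring

end

section

variable {d : ℕ} {X : Type*} [TopologicalSpace X] [ChartedSpace (EuclideanQuadrant (d + 2)) X]
  {M Q : Set X} {g : BilinField d X} [IsManifold (cornerModel d) ∞ X]

theorem isUmbilicCorner_of_isEinstein (hd : 1 ≤ d) (hE : IsEinstein M g) {lam : ℝ}
    (hQ : HasUmbilicBoundary M Q g lam) {φ : X → ℝ} {gbar : CkMetric d X ∞}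
    (hφ : IsDefiningFunction (d := d) M φ) (hcomp : IsCompactification M g φ gbar) {Ω : X → ℝ}
    (hΩ : ContMDiffOn (cornerModel d) 𝓘(ℝ, ℝ) ∞ Ω M) (hΩ0 : ∀ x ∈ M, Ω x ≠ 0) :
    IsUmbilicCorner M Q gbar Ω := by
  intro e he y hy hyl
  have hU := isOpenInQuadrant_target e
  have hGs := contDiffOn_chartComponents_inner gbar (by simp) he.mem_maximalAtlas
  have hpos : ∀ x ∈ (e.extend (cornerModel d)).target,
      (chartComponents e gbar.inner x).PosDef := fun x hx =>
    posDef_chartComponents_inner gbar he.mem_maximalAtlas hx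
  have hφs := hφ.contDiffOn_chart he.mem_maximalAtlas
  have hφ0 : ∀ x ∈ (e.extend (cornerModel d)).target,
      φ ((e.extend (cornerModel d)).symm x) = 0 ↔ x 0 = 0 := fun x hx =>
    (hφ.eq_zero_iff _).trans (he.symm_mem_M_iff hx)
  have hG : ∀ x ∈ (e.extend (cornerModel d)).target, x 0 ≠ 0 → chartComponents e gbar.inner x
      = φ ((e.extend (cornerModel d)).symm x) ^ 2 • chartComponents e g x := fun x hx hx0 =>
    hcomp.chartComponents_eq fun h => hx0 ((he.symm_mem_M_iff hx).1 h)
  have hl0 : Fin.last (d + 1) ≠ 0 := by simp [Fin.ext_iff]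
  have hVm := eventually_transversal_mem_inter hy (faceM_zero y)
  obtain ⟨c, hc⟩ := exists_christoffel_zero_eq_mul hd hU hy (faceM_zero y) hGs hpos hφs hφ0
    (hφ.pderiv_chart_ne_zero he hy (faceM_zero y)) hG (by
      filter_upwards [hVm] with t ht
      exact hE e he.mem_maximalAtlas _ ht.1 fun h => ht.2 ((he.symm_mem_M_iff ht.1).1 h))
  obtain ⟨c', hc'⟩ := exists_christoffel_last_eq_mul hU hy (faceM_zero y) hGs hpos hφs hφ0 hG (by
      filter_upwards [hVm] with t ht
      refine hQ e he _ ht.1 ((he.symm_mem_Q_iff ht.1).2 ?_)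
        fun h => ht.2 ((he.symm_mem_M_iff ht.1).1 h)
      rw [transversal_apply_of_ne hl0, ← Fin.succ_last, faceM_succ, hyl])
  obtain ⟨η, hη⟩ := exists_christoffel_face_eq_mul hU hGs hpos hy hc hc'
  set W := faceM ⁻¹' (e.extend (cornerModel d)).target
  have hWo : IsOpenInQuadrant W := hU.faceM
  set H : EuclideanSpace ℝ (Fin (d + 1)) → Matrix (Fin (d + 1)) (Fin (d + 1)) ℝ := fun x =>
    (chartComponents e gbar.inner (faceM x)).submatrix Fin.succ Fin.succ with hH
  set w : EuclideanSpace ℝ (Fin (d + 1)) → ℝ := fun x =>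
    Ω ((e.extend (cornerModel d)).symm (faceM x)) ^ 2 with hw
  have hHs : ∀ a b, ContDiffOn ℝ ∞ (fun x => H x a b) W := fun a b =>
    (hGs a.succ b.succ).comp contDiff_faceM.contDiffOn fun x hx => hx
  have hHpos : ∀ x ∈ W, (H x).PosDef := fun x hx => (hpos _ hx).submatrix (Fin.succ_injective _)
  have hmem : ∀ x ∈ W, (e.extend (cornerModel d)).symm (faceM x) ∈ M := fun x hx =>
    (he.symm_mem_M_iff hx).2 (faceM_zero x)
  have hws : ContDiffOn ℝ ∞ w W := by
    refine ContDiffOn.pow ?_ 2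
    rw [← contMDiffOn_iff_contDiffOn]
    have h1 := (contMDiffOn_extend_symm_target he.mem_maximalAtlas).comp
      (contMDiffOn_iff_contDiffOn.2 ((contDiff_faceM (d := d)).contDiffOn (s := W)))
      fun x hx => hx
    exact hΩ.comp h1 hmem
  have hw0 : w y ≠ 0 := pow_ne_zero 2 (hΩ0 _ (hmem y hy))
  have hwpos : 0 < w y := lt_of_le_of_ne (sq_nonneg _) hw0.symm
  have hmetric : metricOnM e gbar Ω = fun x => w x • H x := rfl
  have hpos' : (w y • H y).PosDef := (hHpos y hy).smul hwpos
  have hne : √((w y • H y)⁻¹ (Fin.last d) (Fin.last d)) ≠ 0 :=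
    (Real.sqrt_pos.2 hpos'.inv.diag_pos).ne'
  set S := ∑ k, (H y)⁻¹ (Fin.last d) k * (pderiv k w y / (2 * w y)) with hS
  refine ⟨(η - S) / (√((w y • H y)⁻¹ (Fin.last d) (Fin.last d)) * w y), fun a b ha hb => ?_⟩
  rw [hmetric, secondFundForm_eq (by simpa using hpos'.isHermitian) hpos'.det_pos.ne',
    christoffel_smul hWo hy hHs (fun x hx => by simpa using (hHpos x hx).isHermitian)
      (hHpos y hy).det_pos.ne' hws hw0, if_neg ha.symm, if_neg hb.symm, ← hS, hη a b ha hb]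
  change (η * H y a b + (0 + 0 - H y a b * S)) / _ = _ * (w y * H y a b)
  field_simp
  ring

end

theorem mainTheorem8 {d : ℕ} (hd : 1 ≤ d) {X : Type*} [TopologicalSpace X] [T2Space X]
    [SecondCountableTopology X] [ChartedSpace (EuclideanQuadrant (d + 2)) X]
    [IsManifold (cornerModel d) ∞ X] (M Q : Set X) (hX : IsCorneredSpace (d := d) M Q)
    (g : BilinField d X) (lam : ℝ) (hE : IsEinstein M g) (hQ : HasUmbilicBoundary M Q g lam) :
    ((IsCAHMetric ∞ M g ∨ IsAdmissible M Q g) →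
      (∀ (φ : X → ℝ) (gbar : CkMetric d X 0), IsDefiningFunction (d := d) M φ →
        IsCompactification M g φ gbar →
        ∀ p ∈ M ∩ Q, ∀ e, IsAdaptedChart M Q e → p ∈ e.source →
          ∃ θ₀ : ℝ, (∀ θ : ℝ, IsCornerAngle e gbar p θ ↔ θ = θ₀) ∧ Real.cos θ₀ = -lam) ∧
      lam ∈ Set.Ioo (-1 : ℝ) 1) ∧
    (IsCAHMetric ∞ M g →
      ∀ (φ : X → ℝ) (gbar : CkMetric d X ∞), IsDefiningFunction (d := d) M φ →
        IsCompactification M g φ gbar →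
        ∀ Ω : X → ℝ, ContMDiffOn (cornerModel d) 𝓘(ℝ, ℝ) ∞ Ω M → (∀ x ∈ M, Ω x ≠ 0) →
          IsUmbilicCorner M Q gbar Ω) := by
  refine ⟨fun hg => ⟨fun φ gbar hφ hcomp p hp e he hpe =>
    exists_cornerAngle hg hQ hφ hcomp hp he hpe, ?_⟩, fun _ φ gbar hφ hcomp Ω hΩ hΩ0 =>
    isUmbilicCorner_of_isEinstein hd hE hQ hφ hcomp hΩ hΩ0⟩
  obtain ⟨x, hx⟩ := hX.corner_nonempty
  obtain ⟨e, he, hxe⟩ := hX.exists_adapted x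
  obtain ⟨A, hA, hA1, hlam, -⟩ := exists_scalingLimit_lam hg he hQ
    ((e.extend (cornerModel d)).map_source (by rwa [e.extend_source]))
    ((he.mem_M_iff x hxe).1 hx.1) ((he.mem_Q_iff x hxe).1 hx.2)
  exact lam_mem_Ioo hA hA1 hlam
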